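/- \textbf{Setting.} Fix $\mathfrak g=\mathfrak k\oplus\mathfrak p$ with $\mathfrak k=\mathbb R^q$ and $\mathfrak p=\mathbb R^n$, where $\mathfrak p$ carries its standard inner product $\langle\cdot,\cdot\rangle$ and orthonormal basis $X_1,\dots,X_n$. Let $\mathcal H_{q,n}$ be the set of skew-symmetric bilinear maps $\mu:\mathfrak g\times\mathfrak g\to\mathfrak g$ such that: $\mu$ satisfies the Jacobi identity, $\mu(\mathfrak k,\mathfrak k)\subset\mathfrak k$ and $\mu(\mathfrak k,\mathfrak p)\subset\mathfrak p$; the connected Lie subgroup $K_\mu$ with Lie algebra $\mathfrak k$ is closed in the simply connected Lie group $G_\mu$ with Lie algebra $(\mathfrak g,\mu)$; $\mathrm{ad}_\mu Z|_{\mathfrak p}$ is skew-symmetric for every $Z\in\mathfrak k$; and $\{Z\in\mathfrak k:\mu(Z,\mathfrak p)=0\}=0$. Each $\mu\in\mathcal H_{q,n}$ defines a simply connected homogeneous Riemannian manifold $(G_\mu/K_\mu,g_\mu)$, where $g_\mu$ is the $G_\mu$-invariant metric equal to $\langle\cdot,\cdot\rangle$ on $\mathfrak p\cong T_o(G_\mu/K_\mu)$.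 Its Ricci operator is given by the following formula, which defines $\mathrm{Ric}_\mu:\mathfrak p\to\mathfrak p$ for every bilinear $\mu$: $$\langle \mathrm{Ric}_\mu X,Y\rangle=-\tfrac12\sum_{i}\langle\mu_{\mathfrak p}(X,X_i),\mu_{\mathfrak p}(Y,X_i)\rangle+\tfrac14\sum_{i,j}\langle\mu_{\mathfrak p}(X_i,X_j),X\rangle\langle\mu_{\mathfrak p}(X_i,X_j),Y\rangle-\tfrac12\mathrm{tr}(\mathrm{ad}_\mu X\,\mathrm{ad}_\mu Y)-\tfrac12\big(\langle\mu_{\mathfrak p}(H,X),Y\rangle+\langle X,\mu_{\mathfrak p}(H,Y)\rangle\big),$$ where $\mu_{\mathfrak k},\mu_{\mathfrak p}$ denote the $\mathfrak k$- and $\mathfrak p$-components of $\mu|_{\mathfrak p\times\mathfrak p}$ and $H\in\mathfrak p$ is defined by $\langle H,X\rangle=\mathrm{tr}\,\mathrm{ad}_\mu X$ for $X\in\mathfrak p$. Put $h\cdot\mu=h\mu(h^{-1}\cdot,h^{-1}\cdot)$ for $h\in \mathrm{GL}(\mathfrak g)$, and $\pi(E)\mu=E\mu(\cdot,\cdot)-\mu(E\cdot,\cdot)-\mu(\cdot,E\cdot)$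 for $E\in\mathrm{End}(\mathfrak g)$. For $a>0$ let $a\cdot\mu$ be the bracket equal to $\mu$ on $\mathfrak k\times\mathfrak g$ and to $a^2\mu_{\mathfrak k}+a\mu_{\mathfrak p}$ on $\mathfrak p\times\mathfrak p$. A \emph{normalized bracket flow} starting at $\mu_0$ is a solution $\mu(t)$, on an open interval $J\ni 0$, of $$\mu'(t)=-\pi\left(\begin{bmatrix}0&0\\0&\mathrm{Ric}_{\mu(t)}+r(t)I\end{bmatrix}\right)\mu(t),\qquad \mu(0)=\mu_0,$$ for some continuous function $r:J\to\mathbb R$. \textbf{Statement.} Let $\mu_0\in\mathcal H_{q,n}$ be a semi-algebraic soliton, that is, $$\mathrm{Ric}_{\mu_0}=cI+\tfrac12(D_{\mathfrak p}+D_{\mathfrak p}^t),\qquad c\in\mathbb R,\qquad D=\begin{bmatrix}0&\ast\\0&D_{\mathfrak p}\end{bmatrix}\in\mathrm{Der}(\mathfrak g,\mu_0).$$ Let $F$ be a real-valued function, differentiable on $\mathcal H_{q,n}$, such that $F(\mu)=F(\lambda)$ whenever $\mu,\lambda\in\mathcal H_{q,n}$ define isometric homogeneous spaces, such that for some real $d\neq0$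 one has $F(a\cdot\mu)=a^dF(\mu)$ for all $a>0$ and $\mu\in\mathcal H_{q,n}$, and such that $F(\mu_0)\ne0$. Let $A=\tfrac12(D_{\mathfrak p}-D_{\mathfrak p}^t)$ and $$\mu(t)=\begin{bmatrix}I&0\\0&e^{tA}e^{-tD_{\mathfrak p}}\end{bmatrix}\cdot\mu_0,\qquad t\in(-\infty,\infty).$$ Then $\mu(t)\in\mathcal H_{q,n}$ for all $t\in\mathbb R$, the curve $\mu$ is a normalized bracket flow on $\mathbb R$ starting at $\mu_0$, and $F(\mu(t))=F(\mu_0)$ for all $t\in\mathbb R$. Moreover, it is the only such flow: every normalized bracket flow starting at $\mu_0$, on any open interval $J\ni0$, along which $F$ is constantly equal to $F(\mu_0)$ coincides with $\mu(t)$ on $J$. -/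

import Mathlib

open scoped Manifold ContDiff ENNReal InnerProductSpace

noncomputable section

namespace BracketFlow

/-- The isotropy summand `𝔨 = ℝ^q` of the fixed decomposition `𝔤 = 𝔨 ⊕ 𝔭`. -/
abbrev Kk (q : ℕ) : Type := EuclideanSpace ℝ (Fin q)

/-- The tangent summand `𝔭 = ℝ^n`, with its standard inner product. -/
abbrev Pp (n : ℕ) : Type := EuclideanSpace ℝ (Fin n)

/-- The vector space `𝔤 = 𝔨 ⊕ 𝔭`. Its norm is used only for the topology. -/
abbrev Gg (q n : ℕ) : Type := Kk q × Pp n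

/-- The space of all bilinear maps `𝔤 × 𝔤 → 𝔤`. The space `V_{q+n}` of brackets consists of the
skew-symmetric ones. -/
abbrev Bil (q n : ℕ) : Type := Gg q n →L[ℝ] Gg q n →L[ℝ] Gg q n

variable {q n : ℕ}

/-- The adjoint map `ad_μ X = μ(X, ·)`. -/
def ad (μ : Bil q n) (X : Gg q n) : Gg q n →L[ℝ] Gg q n := μ X

/-- An element of `𝔨`, seen in `𝔤`. -/
def inK (Z : Kk q) : Gg q n := (Z, 0)

/-- An element of `𝔭`, seen in `𝔤`. -/
def inP (X : Pp n) : Gg q n := (0, X)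

/-! ### The group action and its derivative -/

/-- The bilinear map `(X, Y) ↦ L (μ (A X) (B Y))`. -/
def bil (L A B : Gg q n →L[ℝ] Gg q n) (μ : Bil q n) : Bil q n :=
  (ContinuousLinearMap.compL ℝ (Gg q n) (Gg q n) (Gg q n) L).comp (μ.bilinearComp A B)

lemma bil_apply (L A B : Gg q n →L[ℝ] Gg q n) (μ : Bil q n) (X Y : Gg q n) :
    bil L A B μ X Y = L (μ (A X) (B Y)) := rfl

/-- The action `(h · μ)(X, Y) = h μ(h⁻¹ X, h⁻¹ Y)` of `GL(𝔤)`. -/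
def act (h : Gg q n ≃L[ℝ] Gg q n) (μ : Bil q n) : Bil q n :=
  bil h h.symm h.symm μ

lemma act_apply (h : Gg q n ≃L[ℝ] Gg q n) (μ : Bil q n) (X Y : Gg q n) :
    act h μ X Y = h (μ (h.symm X) (h.symm Y)) := rfl

/-- The representation `π(A)μ = A μ(·,·) - μ(A·,·) - μ(·,A·)` of `𝔤𝔩(𝔤)`. -/
def piRep (A : Gg q n →L[ℝ] Gg q n) (μ : Bil q n) : Bil q n :=
  bil A (.id ℝ _) (.id ℝ _) μ - bil (.id ℝ _) A (.id ℝ _) μ - bil (.id ℝ _) (.id ℝ _) A μ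

lemma piRep_apply (A : Gg q n →L[ℝ] Gg q n) (μ : Bil q n) (X Y : Gg q n) :
    piRep A μ X Y = A (μ X Y) - μ (A X) Y - μ X (A Y) := rfl

/-- The block matrix `[0 0; 0 B]`. -/
def zeroBlock (B : Pp n →L[ℝ] Pp n) : Gg q n →L[ℝ] Gg q n :=
  (0 : Kk q →L[ℝ] Kk q).prodMap B

/-- The block matrix `[I 0; 0 h]`. -/
def idBlock (h : Pp n ≃L[ℝ] Pp n) : Gg q n ≃L[ℝ] Gg q n :=
  (ContinuousLinearEquiv.refl ℝ (Kk q)).prodCongr h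

lemma isUnit_exp (B : Pp n →L[ℝ] Pp n) : IsUnit (NormedSpace.exp B) := by
  let +nondep : NormedAlgebra ℚ (Pp n →L[ℝ] Pp n) := .restrictScalars ℚ ℝ _
  exact NormedSpace.isUnit_exp B

/-- The exponential `e^B` of an endomorphism `B` of `𝔭`, as an element of `GL(𝔭)`. -/
def expGL (B : Pp n →L[ℝ] Pp n) : Pp n ≃L[ℝ] Pp n :=
  ContinuousLinearEquiv.ofUnit (isUnit_exp B).unit

/-- The `𝔭𝔭`-block `D_𝔭 = pr_𝔭 ∘ D|_𝔭` of an endomorphism `D` of `𝔤`. -/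
def pBlock (D : Gg q n →L[ℝ] Gg q n) : Pp n →L[ℝ] Pp n :=
  (ContinuousLinearMap.snd ℝ (Kk q) (Pp n)).comp
    (D.comp (ContinuousLinearMap.inr ℝ (Kk q) (Pp n)))

/-- The geometric rescaling `c · μ`: it equals `μ` on `𝔨 × 𝔨` and `𝔨 × 𝔭`, and on `𝔭 × 𝔭` it is
`c² μ_𝔨 + c μ_𝔭`. -/
def scale (c : ℝ) (μ : Bil q n) : Bil q n :=
  μ - bil (.id ℝ _) (zeroBlock (.id ℝ _)) (zeroBlock (.id ℝ _)) μ
    + bil (((c ^ 2) • ContinuousLinearMap.id ℝ (Kk q)).prodMap (c • ContinuousLinearMap.id ℝ (Pp n)))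
        (zeroBlock (.id ℝ _)) (zeroBlock (.id ℝ _)) μ

lemma scale_kg (c : ℝ) (μ : Bil q n) (Z : Kk q) (Y : Gg q n) :
    scale c μ (inK Z) Y = μ (inK Z) Y := by
  have h : zeroBlock (ContinuousLinearMap.id ℝ (Pp n)) (inK Z : Gg q n) = 0 := by
    ext <;> simp [inK, zeroBlock]
  simp only [scale, add_apply, sub_apply, bil_apply, h, map_zero, zero_apply, sub_zero,
    add_zero]

lemma scale_pp (c : ℝ) (μ : Bil q n) (X Y : Pp n) :
    scale c μ (inP X) (inP Y) =
      (c ^ 2 • (μ (inP X) (inP Y)).1, c • (μ (inP X) (inP Y)).2) := by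
  have h (W : Pp n) : zeroBlock (ContinuousLinearMap.id ℝ (Pp n)) (inP W : Gg q n) = inP W := by
    ext <;> simp [inP, zeroBlock]
  simp only [scale, add_apply, sub_apply, bil_apply, h, ContinuousLinearMap.id_apply, sub_self,
    zero_add]
  rfl

/-- `D` is a derivation of the algebra `(𝔤, μ)`. -/
def IsDerivation (μ : Bil q n) (D : Gg q n →L[ℝ] Gg q n) : Prop :=
  ∀ X Y, D (μ X Y) = μ (D X) Y + μ X (D Y)

/-! ### Homogeneous spaces -/

/-- A simply connected Lie group `G_μ` with Lie algebra `(𝔤, μ)`: a simply connected Lie group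
together with an isomorphism from `(𝔤, μ)` onto its Lie algebra of left-invariant vector fields. -/
structure GroupOf (μ : Bil q n) where
  G : Type
  [top : TopologicalSpace G]
  [grp : Group G]
  [charted : ChartedSpace (Gg q n) G]
  [lie : LieGroup 𝓘(ℝ, Gg q n) ∞ G]
  [t2 : T2Space G]
  [sc : SimplyConnectedSpace G]
  toLie : Gg q n ≃L[ℝ] GroupLieAlgebra 𝓘(ℝ, Gg q n) G
  toLie_bracket : ∀ X Y, toLie (μ X Y) = ⁅toLie X, toLie Y⁆

attribute [instance] GroupOf.top GroupOf.grp GroupOf.charted GroupOf.lie GroupOf.t2 GroupOf.sc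

namespace GroupOf

variable {μ : Bil q n} (S : GroupOf μ)

/-- The left-invariant vector field on `G_μ` defined by `X ∈ 𝔤`. -/
def field (X : Gg q n) (g : S.G) : TangentSpace 𝓘(ℝ, Gg q n) g :=
  mulInvariantVectorField (S.toLie X) g

/-- The connected Lie subgroup `K_μ` of `G_μ` with Lie algebra `𝔨`, that is, the subgroup generated
by the elements `exp Z`, `Z ∈ 𝔨`; here `exp Z` is the value at time `1` of the integral curve
through the identity of the left-invariant field of `Z`. -/
def K : Subgroup S.G :=
  Subgroup.closure {g | ∃ (Z : Kk q) (γ : ℝ → S.G),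
    IsMIntegralCurve γ (S.field (inK Z)) ∧ γ 0 = 1 ∧ γ 1 = g}

/-- The Riemannian distance of `(G_μ/K_μ, g_μ)`. Every `C¹` curve in `G_μ/K_μ` is the projection
of a `C¹` curve `γ` in `G_μ`; if `γ' = dL_γ ξ` with `ξ(t) ∈ 𝔤`, then the velocity of the projected
curve at time `t` is the translate by `γ(t)` of the class of `ξ(t)` in `𝔤/𝔨 ≅ 𝔭 ≅ T_o(G_μ/K_μ)`, so
that its `g_μ`-length is the length of the `𝔭`-component of `ξ(t)`. -/
def rdist (x y : S.G ⧸ S.K) : ℝ≥0∞ :=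
  ⨅ (γ : ℝ → S.G) (ξ : ℝ → Gg q n) (_ : Continuous ξ)
    (_ : ∀ t, HasMFDerivAt 𝓘(ℝ, ℝ) 𝓘(ℝ, Gg q n) γ t
      ((1 : ℝ →L[ℝ] ℝ).smulRight (S.field (ξ t) (γ t))))
    (_ : (γ 0 : S.G ⧸ S.K) = x) (_ : (γ 1 : S.G ⧸ S.K) = y),
    ∫⁻ t in Set.Icc (0 : ℝ) 1, ‖(ξ t).2‖ₑ

end GroupOf

/-- The set `𝓗_{q,n}` of the brackets that define an almost-effective simply connected homogeneous
space `(G_μ/K_μ, g_μ)` with reductive decomposition `𝔤 = 𝔨 ⊕ 𝔭`. -/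
structure IsHomogeneous (μ : Bil q n) : Prop where
  alt : ∀ X, μ X X = 0
  jacobi : ∀ X Y Z, μ X (μ Y Z) + μ Y (μ Z X) + μ Z (μ X Y) = 0
  kk : ∀ Z W, (μ (inK Z) (inK W)).2 = 0
  kp : ∀ Z X, (μ (inK Z) (inP X)).1 = 0
  closed : ∃ S : GroupOf μ, IsClosed (S.K : Set S.G)
  skew : ∀ Z X Y,
    ⟪(μ (inK Z) (inP X)).2, Y⟫_ℝ = -⟪X, (μ (inK Z) (inP Y)).2⟫_ℝ
  effective : ∀ Z, (∀ X, μ (inK Z) (inP X) = 0) → Z = 0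

/-- The subset `𝓗_{q,n}` of the space of brackets. -/
def Hqn (q n : ℕ) : Set (Bil q n) := {μ | IsHomogeneous μ}

/-- The homogeneous spaces `(G_μ/K_μ, g_μ)` and `(G_ν/K_ν, g_ν)` are isometric: there is a bijection
preserving the Riemannian distances. Between connected Riemannian manifolds such bijections are the
same as Riemannian isometries (Myers and Steenrod). The Lie groups are unique up to isomorphism. -/
def Isometric (μ ν : Bil q n) : Prop :=
  ∃ (S : GroupOf μ) (T : GroupOf ν) (f : S.G ⧸ S.K ≃ T.G ⧸ T.K),
    ∀ x y, T.rdist (f x) (f y) = S.rdist x y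

/-! ### The Ricci operator -/

/-- The standard orthonormal basis `X_1, …, X_n` of `𝔭`. -/
def e (i : Fin n) : Pp n := EuclideanSpace.basisFun (Fin n) ℝ i

/-- The `𝔭`-component `μ_𝔭(X, Y)` for `X, Y ∈ 𝔭`. -/
def brP (μ : Bil q n) (X Y : Pp n) : Pp n := (μ (inP X) (inP Y)).2

/-- The Killing form `B_μ(X, Y) = tr (ad_μ X ad_μ Y)`. -/
def killing (μ : Bil q n) (X Y : Gg q n) : ℝ :=
  LinearMap.trace ℝ (Gg q n) ((ad μ X).comp (ad μ Y) : Gg q n →L[ℝ] Gg q n).toLinearMap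

/-- The vector `H_μ ∈ 𝔭` with `⟨H_μ, X⟩ = tr (ad_μ X)` for all `X ∈ 𝔭`. -/
def meanVec (μ : Bil q n) : Pp n :=
  ∑ i, LinearMap.trace ℝ (Gg q n) (ad μ (inP (e i))).toLinearMap • e i

/-- The Ricci curvature of `(G_μ/K_μ, g_μ)` at the origin, as a bilinear form on `𝔭`:
`⟨M_μ X, Y⟩ - ½ B_μ(X, Y) - ⟨S(ad_μ H_μ|_𝔭)X, Y⟩`, where `S` is the symmetric part and
`⟨M_μ X, Y⟩ = -½ ∑ ⟨μ_𝔭(X,X_i),X_j⟩⟨μ_𝔭(Y,X_i),X_j⟩ + ¼ ∑ ⟨μ_𝔭(X_i,X_j),X⟩⟨μ_𝔭(X_i,X_j),Y⟩`. -/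
def ricForm (μ : Bil q n) (X Y : Pp n) : ℝ :=
  -(1 / 2) * ∑ i, ⟪brP μ X (e i), brP μ Y (e i)⟫_ℝ
    + (1 / 4) * ∑ i, ∑ j, ⟪brP μ (e i) (e j), X⟫_ℝ * ⟪brP μ (e i) (e j), Y⟫_ℝ
    - (1 / 2) * killing μ (inP X) (inP Y)
    - (1 / 2) * (⟪brP μ (meanVec μ) X, Y⟫_ℝ + ⟪X, brP μ (meanVec μ) Y⟫_ℝ)

/-- The Ricci operator `Ric_μ : 𝔭 → 𝔭`, with `⟨Ric_μ X_j, X_i⟩ = ric_μ(X_i, X_j)`. -/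
def Ric (μ : Bil q n) : Pp n →L[ℝ] Pp n :=
  Matrix.toEuclideanCLM (𝕜 := ℝ) (Matrix.of fun i j => ricForm μ (e i) (e j))

/-! ### The bracket flow -/

/-- `μ` solves on `J` the normalized bracket flow with normalization function `r`,
`μ' = -π([0 0; 0 Ric_μ + r I]) μ`, `μ(0) = μ₀`. -/
def IsBracketFlow (J : Set ℝ) (r : ℝ → ℝ) (μ₀ : Bil q n) (μ : ℝ → Bil q n) : Prop :=
  μ 0 = μ₀ ∧ ∀ t ∈ J,
    HasDerivAt μ (-piRep (zeroBlock (Ric (μ t) + r t • ContinuousLinearMap.id ℝ (Pp n))) (μ t)) t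

/-- `(G_μ/K_μ, g_μ)` is a semi-algebraic soliton with cosmological constant `c` and derivation
`D = [0 *; 0 D_𝔭]`, that is, `Ric_μ = c I + ½ (D_𝔭 + D_𝔭ᵗ)`; the automorphisms `e^{tD}` of `(𝔤, μ)`
are then the differentials of those that generate the self-similar Ricci flow solution. -/
structure IsSemiAlgebraicSoliton (μ : Bil q n) (c : ℝ) (D : Gg q n →L[ℝ] Gg q n) : Prop where
  derivation : IsDerivation μ D
  vanish : ∀ Z, D (inK Z) = 0
  ric : Ric μ = c • ContinuousLinearMap.id ℝ (Pp n)
    + (1 / 2 : ℝ) • (pBlock D + ContinuousLinearMap.adjoint (pBlock D))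

/-- The operator `A = ½ (D_𝔭 - D_𝔭ᵗ)`. -/
def skewPart (B : Pp n →L[ℝ] Pp n) : Pp n →L[ℝ] Pp n :=
  (1 / 2 : ℝ) • (B - ContinuousLinearMap.adjoint B)

/-- The curve `[I 0; 0 e^{tA} e^{-tD_𝔭}] · μ₀`, where `A = ½ (D_𝔭 - D_𝔭ᵗ)`. -/
def solitonCurve (D : Gg q n →L[ℝ] Gg q n) (μ₀ : Bil q n) (t : ℝ) : Bil q n :=
  act (idBlock (expGL (t • skewPart (pBlock D)) * expGL (-(t • pBlock D)))) μ₀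

end BracketFlow

end

open scoped Manifold ContDiff ENNReal InnerProductSpace

noncomputable section

namespace BracketFlow

variable {q n : ℕ}

/-! ### Exponentials of endomorphisms -/

section Exp

variable {E : Type*} [NormedAddCommGroup E] [NormedSpace ℝ E] [CompleteSpace E]

/-! Write `B = D_𝔭 = S + A` with symmetric part `S` and skew part `A`. Since `D` is a derivation,
`e^{tD}` is an automorphism of `μ₀` and may be inserted freely: `[I 0; 0 e^{-tB}] · μ₀ = u · μ₀`
with `u = [I 0; 0 e^{-tB}] e^{tD}`. This `u` has the form `[I β; 0 I]`, so `u · μ₀` describes the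
same homogeneous metric, seen from another reductive complement. It therefore keeps the isometry
class (`isometric_act`) and the Ricci form (`ricForm_unipotent`, by direct computation). The
remaining factor `e^{tA}` is orthogonal and only conjugates the Ricci operator, so `Ric = cI +
e^{tA} S e^{-tA}` along the curve. On the other hand, differentiating `e^{tA} e^{-tB}` gives
`-(e^{tA} S e^{-tA}) e^{tA} e^{-tB}`, because `A - B = -S`. Hence the curve is a normalized bracket
flow with `r = -c`, and `F` is constant on it by isometry invariance. The curve stays in `𝓗_{q,n}`
because `B` and `Bᵗ` commute with the isotropy representation. For uniqueness, every normalized flow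
that meets the curve is locally a rescaling and reparametrization of it, `e^{α(t)} · μ(τ(t))`, where
`α' = r + c e^{2α}` and `τ' = e^{2α}` (`exists_local_rescaling`, `hasDerivAt_homothety_frame`, and
uniqueness for ODEs). Constancy of `F` reads `e^{dα} = 1`, so `α = 0`, then `τ' = 1`, and the two
flows agree locally. Connectedness of the interval makes the agreement global. -/

lemma exp_neg_mul_exp (B : E →L[ℝ] E) : NormedSpace.exp (-B) * NormedSpace.exp B = 1 := by
  let : NormedAlgebra ℚ (E →L[ℝ] E) := .restrictScalars ℚ ℝ _
  rw [← NormedSpace.exp_add_of_commute (Commute.refl B).neg_left, neg_add_cancel,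
    NormedSpace.exp_zero]

lemma exp_mul_exp_neg (B : E →L[ℝ] E) : NormedSpace.exp B * NormedSpace.exp (-B) = 1 := by
  simpa using exp_neg_mul_exp (-B)

/-- The exponential of an endomorphism as an invertible map. -/
def expEquiv (B : E →L[ℝ] E) : E ≃L[ℝ] E :=
  ContinuousLinearEquiv.equivOfInverse (NormedSpace.exp B) (NormedSpace.exp (-B))
    (fun x => congr($(exp_neg_mul_exp B) x)) (fun x => congr($(exp_mul_exp_neg B) x))

lemma hasDerivAt_exp_smul (B : E →L[ℝ] E) (t : ℝ) :
    HasDerivAt (fun s : ℝ => NormedSpace.exp (s • B)) (NormedSpace.exp (t • B) * B) t :=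
  hasDerivAt_exp_smul_const B t

lemma hasDerivAt_exp_smul' (B : E →L[ℝ] E) (t : ℝ) :
    HasDerivAt (fun s : ℝ => NormedSpace.exp (s • B)) (B * NormedSpace.exp (t • B)) t :=
  hasDerivAt_exp_smul_const' B t

lemma hasDerivAt_exp_neg_smul (B : E →L[ℝ] E) (t : ℝ) :
    HasDerivAt (fun s : ℝ => NormedSpace.exp (-(s • B))) (-(NormedSpace.exp (-(t • B)) * B)) t := by
  simpa using hasDerivAt_exp_smul (-B) t

lemma hasDerivAt_exp_neg_smul' (B : E →L[ℝ] E) (t : ℝ) :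
    HasDerivAt (fun s : ℝ => NormedSpace.exp (-(s • B))) (-(B * NormedSpace.exp (-(t • B)))) t := by
  simpa using hasDerivAt_exp_smul' (-B) t

omit [CompleteSpace E] in
lemma eq_of_forall_hasDerivAt_zero {f : ℝ → E} (h : ∀ t, HasDerivAt f 0 t) (t : ℝ) :
    f t = f 0 :=
  is_const_of_deriv_eq_zero (fun s => (h s).differentiableAt) (fun s => (h s).deriv) t 0

/-- Intertwining maps intertwine the exponentials. -/
lemma comp_exp_smul_eq {E' : Type*} [NormedAddCommGroup E'] [NormedSpace ℝ E'] [CompleteSpace E']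
    (P : E →L[ℝ] E') (B : E →L[ℝ] E) (C : E' →L[ℝ] E') (h : P ∘L B = C ∘L P) (t : ℝ) :
    P ∘L NormedSpace.exp (t • B) = NormedSpace.exp (t • C) ∘L P := by
  -- The curve `e^{-sC} P e^{sB}` has zero derivative, hence equals its value `P` at `s = 0`.
  have key : ∀ s : ℝ, HasDerivAt
      (fun s : ℝ => (NormedSpace.exp (-(s • C)) ∘L P) ∘L NormedSpace.exp (s • B)) 0 s := by
    intro s
    have h1 := (hasDerivAt_exp_neg_smul C s).clm_comp (hasDerivAt_const s P)
    convert h1.clm_comp (hasDerivAt_exp_smul' B s) using 1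
    ext x
    have hx := congr($h (NormedSpace.exp (s • B) x))
    simp only [ContinuousLinearMap.comp_apply] at hx
    simp [hx]
  have h0 := eq_of_forall_hasDerivAt_zero key t
  simp only [zero_smul, neg_zero, NormedSpace.exp_zero] at h0
  ext x
  have h2 := congr(NormedSpace.exp (t • C) ($h0 x))
  have h3 := congr($(exp_mul_exp_neg (t • C)) (P (NormedSpace.exp (t • B) x)))
  simp only [ContinuousLinearMap.comp_apply, mul_apply_eq_comp,
    one_apply_eq_self] at h2 h3 ⊢
  rw [← h3, h2]

end Exp

lemma expGL_eq_expEquiv (B : Pp n →L[ℝ] Pp n) : expGL B = expEquiv B := by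
  exact ContinuousLinearEquiv.ext (funext fun x => rfl)

lemma expGL_symm (B : Pp n →L[ℝ] Pp n) : (expGL B).symm = expGL (-B) := by
  rw [expGL_eq_expEquiv, expGL_eq_expEquiv]
  exact ContinuousLinearEquiv.ext (funext fun x => rfl)

/-! ### The action -/

lemma bil_ext {μ ν : Bil q n} (h : ∀ X Y, μ X Y = ν X Y) : μ = ν :=
  ContinuousLinearMap.ext fun X => ContinuousLinearMap.ext fun Y => h X Y

lemma act_mul (g h : Gg q n ≃L[ℝ] Gg q n) (μ : Bil q n) : act (g * h) μ = act g (act h μ) := by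
  refine bil_ext fun X Y => ?_
  rw [act_apply, act_apply, act_apply]
  rfl

section Derivative

variable {E : Type*} [NormedAddCommGroup E] [NormedSpace ℝ E]

lemma hasDerivAt_compL_comp {L A B : ℝ → E →L[ℝ] E} {L' A' B' : E →L[ℝ] E} {t : ℝ}
    (hL : HasDerivAt L L' t) (hA : HasDerivAt A A' t) (hB : HasDerivAt B B' t)
    (μ : E →L[ℝ] E →L[ℝ] E) :
    HasDerivAt
      (fun s => (ContinuousLinearMap.compL ℝ E E E (L s)).comp (μ.bilinearComp (A s) (B s)))
      ((ContinuousLinearMap.compL ℝ E E E L').comp (μ.bilinearComp (A t) (B t))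
        + (ContinuousLinearMap.compL ℝ E E E (L t)).comp (μ.bilinearComp A' (B t))
        + (ContinuousLinearMap.compL ℝ E E E (L t)).comp (μ.bilinearComp (A t) B')) t := by
  have h1 := (hasDerivAt_const t μ).clm_comp hA
  have h2 : HasDerivAt (fun s => (ContinuousLinearMap.compL ℝ E E E).flip (B s))
      ((ContinuousLinearMap.compL ℝ E E E).flip B') t :=
    ((ContinuousLinearMap.compL ℝ E E E).flip.hasFDerivAt).comp_hasDerivAt t hB
  have h3 : HasDerivAt (fun s => ContinuousLinearMap.compL ℝ E E E (L s))
      (ContinuousLinearMap.compL ℝ E E E L') t :=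
    ((ContinuousLinearMap.compL ℝ E E E).hasFDerivAt).comp_hasDerivAt t hL
  refine (h3.clm_comp (h2.clm_comp h1)).congr_deriv
    (ContinuousLinearMap.ext fun X => ContinuousLinearMap.ext fun Y => ?_)
  simp only [add_apply, ContinuousLinearMap.comp_apply, ContinuousLinearMap.compL_apply,
    ContinuousLinearMap.bilinearComp_apply, ContinuousLinearMap.flip_apply, zero_apply, map_add,
    zero_add]
  abel

end Derivative

/-- The derivative of a curve `G(t) · μ` is `π(E) (G(t) · μ)` if `G' = E G`. -/
lemma hasDerivAt_act {G : ℝ → Gg q n ≃L[ℝ] Gg q n} {E : Gg q n →L[ℝ] Gg q n} {t : ℝ}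
    (h : HasDerivAt (fun s => (G s : Gg q n →L[ℝ] Gg q n)) (E ∘L (G t : Gg q n →L[ℝ] Gg q n)) t)
    (h' : HasDerivAt (fun s => ((G s).symm : Gg q n →L[ℝ] Gg q n))
      (-(((G t).symm : Gg q n →L[ℝ] Gg q n) ∘L E)) t) (μ : Bil q n) :
    HasDerivAt (fun s => act (G s) μ) (piRep E (act (G t) μ)) t := by
  refine (hasDerivAt_compL_comp h h' h' μ).congr_deriv (bil_ext fun X Y => ?_)
  simp only [piRep_apply, act_apply, add_apply, ContinuousLinearMap.comp_apply,
    ContinuousLinearMap.compL_apply, ContinuousLinearMap.bilinearComp_apply, neg_apply, map_neg,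
    ContinuousLinearEquiv.coe_coe]
  abel

/-- `D` commutes with its own exponentials, so `π(D)` can be applied before the action instead of
after it. In this form the derivative visibly vanishes for a derivation. -/
lemma hasDerivAt_act_exp (D : Gg q n →L[ℝ] Gg q n) (μ : Bil q n) (t : ℝ) :
    HasDerivAt (fun s : ℝ => act (expEquiv (s • D)) μ)
      (act (expEquiv (t • D)) (piRep D μ)) t := by
  have h := hasDerivAt_act (G := fun s => expEquiv (s • D)) (E := D) (t := t)
    (hasDerivAt_exp_smul' D t) (hasDerivAt_exp_neg_smul D t) μ
  convert h using 1
  have c1 : ∀ s : ℝ, ∀ x, D (NormedSpace.exp (s • D) x) = NormedSpace.exp (s • D) (D x) :=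
    fun s x => congr($(comp_exp_smul_eq D D D rfl s) x)
  have c2 : ∀ x, D (expEquiv (t • D) x) = expEquiv (t • D) (D x) := c1 t
  have c3 : ∀ x, D ((expEquiv (t • D)).symm x) = (expEquiv (t • D)).symm (D x) := fun x => by
    have := c1 (-t) x
    rwa [show -t • D = -(t • D) from neg_smul t D] at this
  refine bil_ext fun X Y => ?_
  simp only [piRep_apply, act_apply, map_sub, c2, c3]

lemma IsDerivation.piRep_eq_zero {μ : Bil q n} {D : Gg q n →L[ℝ] Gg q n} (h : IsDerivation μ D) :
    piRep D μ = 0 := by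
  refine bil_ext fun X Y => ?_
  rw [piRep_apply, h X Y]
  simp

lemma act_one (μ : Bil q n) : act 1 μ = μ := by
  refine bil_ext fun X Y => ?_
  rw [act_apply]
  rfl

/-- The exponentials of a derivation are automorphisms. -/
lemma IsDerivation.act_exp {μ : Bil q n} {D : Gg q n →L[ℝ] Gg q n} (h : IsDerivation μ D) (t : ℝ) :
    act (expEquiv (t • D)) μ = μ := by
  have h1 : ∀ s : ℝ, HasDerivAt (fun s : ℝ => act (expEquiv (s • D)) μ) 0 s := fun s => by
    have h2 := hasDerivAt_act_exp D μ s
    rw [h.piRep_eq_zero] at h2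
    convert h2 using 1
    refine bil_ext fun X Y => ?_
    simp [act_apply]
  rw [eq_of_forall_hasDerivAt_zero (f := fun s : ℝ => act (expEquiv (s • D)) μ) h1 t]
  have : expEquiv ((0 : ℝ) • D) = 1 := by
    refine ContinuousLinearEquiv.ext (funext fun x => ?_)
    change NormedSpace.exp ((0 : ℝ) • D) x = x
    have h0 : (0 : ℝ) • D = 0 := zero_smul ℝ D
    rw [h0, NormedSpace.exp_zero]
    rfl
  rw [this, act_one]

/-- With `g = a⁻¹I`, each argument in `𝔭` contributes a factor `a` and each output in `𝔭` a factor
`a⁻¹`. These cancel on `𝔨 × 𝔭` and leave `a²` and `a` on the two components of `𝔭 × 𝔭`. Geometric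
rescaling thus becomes part of the linear action. -/
lemma scale_eq_act {μ : Bil q n} (alt : ∀ X, μ X X = 0)
    (kk : ∀ Z W, (μ (inK Z) (inK W)).2 = 0) (kp : ∀ Z X, (μ (inK Z) (inP X)).1 = 0)
    {a : ℝ} {g : Pp n ≃L[ℝ] Pp n} (hg : ∀ X, g X = a⁻¹ • X) (hg' : ∀ X, g.symm X = a • X)
    (ha : a ≠ 0) :
    scale a μ = act (idBlock g) μ := by
  have skew : ∀ X Y, μ X Y = -μ Y X := fun X Y => by
    have := alt (X + Y)
    simp only [map_add, add_apply, alt, zero_add, add_zero] at this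
    rw [eq_neg_iff_add_eq_zero, add_comm]; exact this
  have hdec : ∀ X : Gg q n, X = inK X.1 + inP X.2 := fun X => by ext <;> simp [inK, inP]
  have e1 : ∀ Z, (idBlock g).symm (inK Z : Gg q n) = inK Z := fun Z => by
    change ((Z, g.symm 0) : Gg q n) = _
    simp [inK]
  have e2 : ∀ X, (idBlock g).symm (inP X : Gg q n) = a • inP X := fun X => by
    change ((0, g.symm X) : Gg q n) = _
    simp [inP, hg']
  have e3 : ∀ X : Gg q n, idBlock g X = (X.1, a⁻¹ • X.2) := fun X => by
    change ((X.1, g X.2) : Gg q n) = _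
    simp [hg]
  have kg : ∀ Z Y, scale a μ (inK Z) Y = act (idBlock g) μ (inK Z) Y := fun Z Y => by
    rw [scale_kg, hdec Y, act_apply]
    simp only [map_add, e1, e2, map_smul]
    rw [e3, e3]
    ext1 <;> simp [kk, kp, smul_smul, ha]
  have pp : ∀ X Y, scale a μ (inP X) (inP Y) = act (idBlock g) μ (inP X) (inP Y) := fun X Y => by
    rw [scale_pp, act_apply]
    simp only [e2, map_smul, smul_apply, e3]
    ext1
    · simp [smul_smul, sq]
    · simp [smul_smul, ha]
  have sskew : ∀ X Z, scale a μ (inP X) (inK Z) = -scale a μ (inK Z) (inP X) := fun X Z => by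
    have h : zeroBlock (ContinuousLinearMap.id ℝ (Pp n)) (inK Z : Gg q n) = 0 := by
      ext <;> simp [inK, zeroBlock]
    simp only [scale, add_apply, sub_apply, bil_apply, h, map_zero, sub_zero, add_zero,
      zero_apply]
    exact skew _ _
  have askew : ∀ X Y, act (idBlock g) μ X Y = -act (idBlock g) μ Y X := fun X Y => by
    rw [act_apply, skew, map_neg, act_apply]
  refine bil_ext fun X Y => ?_
  rw [hdec X, map_add, map_add, add_apply, add_apply, kg]
  congr 1
  rw [hdec Y, map_add, map_add, pp, sskew, kg, askew, neg_neg]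

/-! ### Change of the identification of the Lie algebra -/

namespace GroupOf

variable {μ : Bil q n}

/-- The Lie group of `μ` with the identification of its Lie algebra composed with `v⁻¹`, as a Lie
group of `v · μ`. -/
def transport (S : GroupOf μ) (v : Gg q n ≃L[ℝ] Gg q n) : GroupOf (act v μ) where
  G := S.G
  toLie := v.symm.trans S.toLie
  toLie_bracket X Y := by
    rw [act_apply]
    simp only [ContinuousLinearEquiv.trans_apply, ContinuousLinearEquiv.symm_apply_apply]
    exact S.toLie_bracket _ _

lemma transport_field (S : GroupOf μ) (v : Gg q n ≃L[ℝ] Gg q n) (X : Gg q n) :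
    (S.transport v).field (v X) = S.field X := by
  funext g
  change mulInvariantVectorField (S.toLie (v.symm (v X))) g = _
  rw [ContinuousLinearEquiv.symm_apply_apply]
  rfl

/-- The generating one-parameter subgroups are the same, because `v` fixes `𝔨` pointwise and so
leaves their left-invariant fields unchanged. -/
lemma transport_K (S : GroupOf μ) {v : Gg q n ≃L[ℝ] Gg q n} (hv : ∀ Z, v (inK Z) = inK Z) :
    S.K = (S.transport v).K := by
  have h : ∀ Z, (S.transport v).field (inK Z) = S.field (inK Z) := fun Z => by
    conv_lhs => rw [← hv Z]
    exact S.transport_field v _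
  unfold K
  simp only [h]
  rfl

lemma transport_rdist (S : GroupOf μ) {v : Gg q n ≃L[ℝ] Gg q n} (hv : ∀ Z, v (inK Z) = inK Z)
    (hnorm : ∀ X, ‖(v X).2‖ = ‖X.2‖) (x y : S.G ⧸ S.K) :
    (S.transport v).rdist (Subgroup.quotientEquivOfEq (S.transport_K hv) x)
      (Subgroup.quotientEquivOfEq (S.transport_K hv) y) = S.rdist x y := by
  unfold rdist
  refine iInf_congr fun (γ : ℝ → S.G) => ?_
  -- The curve `γ` in the group is kept; only its logarithmic derivative is relabelled, `ξ ↦ v ξ`,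
  -- which does not change the norm of the `𝔭`-component.
  refine (Equiv.iInf_congr (Equiv.arrowCongr (Equiv.refl ℝ) v.toLinearEquiv.toEquiv)
    fun ξ => ?_).symm
  have hξ : (Equiv.arrowCongr (Equiv.refl ℝ) v.toLinearEquiv.toEquiv) ξ = fun t => v (ξ t) := rfl
  rw [hξ]
  refine iInf_congr_Prop ?_ fun _ => iInf_congr_Prop ?_ fun _ => iInf_congr_Prop ?_ fun _ =>
    iInf_congr_Prop ?_ fun _ => ?_
  · exact v.toHomeomorph.comp_continuous_iff
  · simp only [transport_field]
    rfl
  · exact (Subgroup.quotientEquivOfEq (S.transport_K hv)).injective.eq_iff (a := QuotientGroup.mk (s := S.K) (γ 0))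
  · exact (Subgroup.quotientEquivOfEq (S.transport_K hv)).injective.eq_iff (a := QuotientGroup.mk (s := S.K) (γ 1))
  · refine MeasureTheory.lintegral_congr fun t => ?_
    rw [← ofReal_norm, ← ofReal_norm, hnorm]

end GroupOf

lemma isometric_act {μ : Bil q n} (S : GroupOf μ) {v : Gg q n ≃L[ℝ] Gg q n}
    (hv : ∀ Z, v (inK Z) = inK Z) (hnorm : ∀ X, ‖(v X).2‖ = ‖X.2‖) : Isometric μ (act v μ) :=
  ⟨S, S.transport v, Subgroup.quotientEquivOfEq (S.transport_K hv), S.transport_rdist hv hnorm⟩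

/-! ### The space of brackets -/

lemma act_alt {μ : Bil q n} (h : ∀ X, μ X X = 0) (v : Gg q n ≃L[ℝ] Gg q n) (X : Gg q n) :
    act v μ X X = 0 := by
  rw [act_apply, h, map_zero]

lemma act_jacobi {μ : Bil q n} (h : ∀ X Y Z, μ X (μ Y Z) + μ Y (μ Z X) + μ Z (μ X Y) = 0)
    (v : Gg q n ≃L[ℝ] Gg q n) (X Y Z : Gg q n) :
    act v μ X (act v μ Y Z) + act v μ Y (act v μ Z X) + act v μ Z (act v μ X Y) = 0 := by
  simp only [act_apply, ContinuousLinearEquiv.symm_apply_apply]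
  rw [← map_add, ← map_add, h, map_zero]

lemma idBlock_inK (g : Pp n ≃L[ℝ] Pp n) (Z : Kk q) : idBlock g (inK Z : Gg q n) = inK Z := by
  change ((Z, g 0) : Gg q n) = _
  rw [map_zero]
  rfl

lemma idBlock_inP (g : Pp n ≃L[ℝ] Pp n) (X : Pp n) : idBlock g (inP X : Gg q n) = inP (g X) := rfl

lemma idBlock_snd (g : Pp n ≃L[ℝ] Pp n) (X : Gg q n) : (idBlock g X).2 = g X.2 := rfl

lemma idBlock_fst (g : Pp n ≃L[ℝ] Pp n) (X : Gg q n) : (idBlock g X).1 = X.1 := rfl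

lemma idBlock_symm (g : Pp n ≃L[ℝ] Pp n) :
    (idBlock g : Gg q n ≃L[ℝ] Gg q n).symm = idBlock g.symm := rfl

lemma idBlock_mul (g h : Pp n ≃L[ℝ] Pp n) :
    (idBlock (g * h) : Gg q n ≃L[ℝ] Gg q n) = idBlock g * idBlock h := rfl

lemma inK_add_inP (X : Gg q n) : inK X.1 + inP X.2 = X := by ext <;> simp [inK, inP]

lemma symm_inK {v : Gg q n ≃L[ℝ] Gg q n} (hv : ∀ Z, v (inK Z) = inK Z) (Z : Kk q) :
    v.symm (inK Z) = inK Z := by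
  rw [ContinuousLinearEquiv.symm_apply_eq, hv]

/-- A bracket `[I 0; 0 g] · μ`, where `g` commutes with the isotropy representation of `μ`, is
homogeneous. -/
lemma IsHomogeneous.act_idBlock {μ : Bil q n} (h : IsHomogeneous μ) {g : Pp n ≃L[ℝ] Pp n}
    (hg : ∀ Z X, (μ (inK Z) (inP (g X))).2 = g (μ (inK Z) (inP X)).2) :
    IsHomogeneous (act (idBlock g) μ) := by
  have hs := symm_inK (idBlock_inK (q := q) g)
  -- Commuting with the isotropy means that the bracket on `𝔨 × 𝔭` does not change at all, so
  -- skewness and effectiveness are inherited.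
  have key : ∀ Z X, act (idBlock g) μ (inK Z) (inP X) = μ (inK Z) (inP X) := fun Z X => by
    rw [act_apply, hs, idBlock_symm, idBlock_inP]
    ext1
    · rw [idBlock_fst, h.kp, h.kp]
    · rw [idBlock_snd, ← hg, ContinuousLinearEquiv.apply_symm_apply]
  obtain ⟨S, hS⟩ := h.closed
  refine ⟨act_alt h.alt _, act_jacobi h.jacobi _, fun Z W => ?_, fun Z X => ?_,
    ⟨S.transport (idBlock g), ?_⟩, fun Z X Y => ?_, fun Z hZ => h.effective Z fun X => ?_⟩
  · rw [act_apply, hs, hs, idBlock_snd, h.kk, map_zero]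
  · rw [key, h.kp]
  · rw [← S.transport_K (idBlock_inK g)]
    exact hS
  · rw [key, key, h.skew]
  · rw [← key, hZ]

/-! ### The Ricci form -/

lemma inP_add (X Y : Pp n) : (inP (X + Y) : Gg q n) = inP X + inP Y := by ext <;> simp [inP]

lemma inP_smul (a : ℝ) (X : Pp n) : (inP (a • X) : Gg q n) = a • inP X := by ext <;> simp [inP]

lemma inK_add (X Y : Kk q) : (inK (X + Y) : Gg q n) = inK X + inK Y := by ext <;> simp [inK]

lemma inK_smul (a : ℝ) (X : Kk q) : (inK (a • X) : Gg q n) = a • inK X := by ext <;> simp [inK]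

/-- The `𝔭`-component `μ_𝔭` of the bracket on `𝔭`, as a bilinear map. -/
def brBil (μ : Bil q n) : Pp n →ₗ[ℝ] Pp n →ₗ[ℝ] Pp n :=
  LinearMap.mk₂ ℝ (brP μ) (fun X Y Z => by simp [brP, inP_add]) (fun a X Y => by simp [brP, inP_smul])
    (fun X Y Z => by simp [brP, inP_add]) (fun a X Y => by simp [brP, inP_smul])

lemma brBil_apply (μ : Bil q n) (X Y : Pp n) : brBil μ X Y = brP μ X Y := rfl

lemma inner_e_e (i j : Fin n) : ⟪e i, e j⟫_ℝ = if i = j then 1 else 0 :=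
  (EuclideanSpace.basisFun (Fin n) ℝ).inner_eq_ite i j

lemma sum_inner_smul_e (X : Pp n) : ∑ i, ⟪e i, X⟫_ℝ • e i = X :=
  (EuclideanSpace.basisFun (Fin n) ℝ).sum_repr' X

lemma sum_inner_mul_inner_e (X Y : Pp n) : ∑ i, ⟪X, e i⟫_ℝ * ⟪e i, Y⟫_ℝ = ⟪X, Y⟫_ℝ :=
  (EuclideanSpace.basisFun (Fin n) ℝ).sum_inner_mul_inner X Y

lemma trace_eq_sum_inner_e (L : Pp n →ₗ[ℝ] Pp n) :
    LinearMap.trace ℝ (Pp n) L = ∑ i, ⟪e i, L (e i)⟫_ℝ :=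
  L.trace_eq_sum_inner (EuclideanSpace.basisFun (Fin n) ℝ)

lemma killing_add_left (μ : Bil q n) (X Y Z : Gg q n) :
    killing μ (X + Y) Z = killing μ X Z + killing μ Y Z := by
  unfold killing ad
  rw [← map_add]
  congr 1
  refine LinearMap.ext fun W => ?_
  simp

lemma killing_smul_left (μ : Bil q n) (a : ℝ) (X Z : Gg q n) :
    killing μ (a • X) Z = a * killing μ X Z := by
  unfold killing ad
  rw [← smul_eq_mul, ← map_smul]
  congr 1
  refine LinearMap.ext fun W => ?_
  simp

lemma killing_comm (μ : Bil q n) (X Y : Gg q n) : killing μ X Y = killing μ Y X :=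
  LinearMap.trace_comp_comm' (ad μ Y).toLinearMap (ad μ X).toLinearMap

lemma inner_meanVec (μ : Bil q n) (X : Pp n) :
    ⟪meanVec μ, X⟫_ℝ = LinearMap.trace ℝ (Gg q n) (ad μ (inP X)).toLinearMap := by
  let T : Pp n →ₗ[ℝ] ℝ :=
    { toFun := fun X => LinearMap.trace ℝ (Gg q n) (ad μ (inP X)).toLinearMap
      map_add' := fun X Y => by simp [ad, inP_add]
      map_smul' := fun a X => by simp [ad, inP_smul] }
  change _ = T X
  conv_rhs => rw [← sum_inner_smul_e X]
  simp only [map_sum, map_smul, meanVec, sum_inner, real_inner_smul_left, smul_eq_mul]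
  exact Finset.sum_congr rfl fun i _ => mul_comm _ _

lemma ricForm_comm (μ : Bil q n) (X Y : Pp n) : ricForm μ X Y = ricForm μ Y X := by
  unfold ricForm
  rw [killing_comm μ (inP X), real_inner_comm Y, real_inner_comm _ X, add_comm ⟪Y, _⟫_ℝ]
  simp only [real_inner_comm (brP μ Y _) (brP μ X _), mul_comm ⟪_, X⟫_ℝ]

lemma ricForm_add_left (μ : Bil q n) (X Y Z : Pp n) :
    ricForm μ (X + Y) Z = ricForm μ X Z + ricForm μ Y Z := by
  unfold ricForm
  simp only [← brBil_apply, map_add, LinearMap.add_apply, inner_add_left, inner_add_right, inP_add,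
    killing_add_left, add_mul, Finset.sum_add_distrib]
  ring

lemma ricForm_smul_left (μ : Bil q n) (a : ℝ) (X Z : Pp n) :
    ricForm μ (a • X) Z = a * ricForm μ X Z := by
  unfold ricForm
  simp only [← brBil_apply, map_smul, LinearMap.smul_apply, real_inner_smul_left,
    real_inner_smul_right, inP_smul, killing_smul_left, mul_assoc, ← Finset.mul_sum]
  ring

/-- The Ricci form as a bilinear form. -/
def ricBil (μ : Bil q n) : Pp n →ₗ[ℝ] Pp n →ₗ[ℝ] ℝ :=
  LinearMap.mk₂ ℝ (ricForm μ) (ricForm_add_left μ) (ricForm_smul_left μ)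
    (fun X Y Z => by
      rw [ricForm_comm, ricForm_add_left, ricForm_comm μ Y, ricForm_comm μ Z])
    (fun a X Y => by rw [ricForm_comm, ricForm_smul_left, ricForm_comm μ Y]; rfl)

lemma ricBil_apply (μ : Bil q n) (X Y : Pp n) : ricBil μ X Y = ricForm μ X Y := rfl

lemma inner_e_Ric_e (μ : Bil q n) (i j : Fin n) :
    ⟪e i, Ric μ (e j)⟫_ℝ = ricForm μ (e i) (e j) := by
  rw [e, EuclideanSpace.basisFun_inner, Ric, e, EuclideanSpace.basisFun_apply,
    Matrix.ofLp_toEuclideanCLM]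
  simp [e]

lemma inner_Ric (μ : Bil q n) (X Y : Pp n) : ⟪X, Ric μ Y⟫_ℝ = ricForm μ X Y := by
  rw [← ricBil_apply, ← sum_inner_smul_e X, ← sum_inner_smul_e Y]
  simp only [map_sum, map_smul, LinearMap.sum_apply, LinearMap.smul_apply, sum_inner, inner_sum,
    real_inner_smul_left, real_inner_smul_right, inner_e_Ric_e, ricBil_apply, smul_eq_mul, Finset.mul_sum]

lemma ad_act (v : Gg q n ≃L[ℝ] Gg q n) (μ : Bil q n) (X : Gg q n) :
    (ad (act v μ) X).toLinearMap = v.toLinearEquiv.conj (ad μ (v.symm X)).toLinearMap := rfl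

lemma trace_ad_act (v : Gg q n ≃L[ℝ] Gg q n) (μ : Bil q n) (X : Gg q n) :
    LinearMap.trace ℝ (Gg q n) (ad (act v μ) X).toLinearMap
      = LinearMap.trace ℝ (Gg q n) (ad μ (v.symm X)).toLinearMap := by
  rw [ad_act, LinearMap.trace_conj']

lemma killing_act (v : Gg q n ≃L[ℝ] Gg q n) (μ : Bil q n) (X Y : Gg q n) :
    killing (act v μ) X Y = killing μ (v.symm X) (v.symm Y) := by
  unfold killing
  conv_rhs => rw [← LinearMap.trace_conj' _ v.toLinearEquiv]
  congr 1
  refine LinearMap.ext fun Z => ?_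
  change act v μ X (act v μ Y Z) = v (μ (v.symm X) (μ (v.symm Y) (v.symm Z)))
  rw [act_apply, act_apply, v.symm_apply_apply]

/-! ### Conformal changes of the frame -/

section Conformal

variable {W : Type*} [NormedAddCommGroup W] [InnerProductSpace ℝ W]

/-- The vectors `g⁻¹ e_i` form an orthogonal basis with all squared lengths `k⁻¹`, and `∑ ⟪L e_i, M
e_i⟫` does not depend on the orthonormal basis. -/
lemma sum_inner_conformal {g : Pp n ≃L[ℝ] Pp n} {k : ℝ} (hk : k ≠ 0)
    (hg : ∀ X Y, ⟪g X, g Y⟫_ℝ = k * ⟪X, Y⟫_ℝ) (L M : Pp n →ₗ[ℝ] W) :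
    ∑ i, ⟪L (g.symm (e i)), M (g.symm (e i))⟫_ℝ = k⁻¹ * ∑ i, ⟪L (e i), M (e i)⟫_ℝ := by
  have hw : ∀ i j, ⟪e j, g.symm (e i)⟫_ℝ = k⁻¹ * ⟪g (e j), e i⟫_ℝ := fun i j => by
    have := hg (e j) (g.symm (e i))
    rw [g.apply_symm_apply] at this
    rw [this, inv_mul_cancel_left₀ hk]
  have hexp : ∀ i, ⟪L (g.symm (e i)), M (g.symm (e i))⟫_ℝ
      = ∑ j, ∑ l, k⁻¹ * k⁻¹ * (⟪g (e j), e i⟫_ℝ * ⟪e i, g (e l)⟫_ℝ) * ⟪L (e j), M (e l)⟫_ℝ :=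
    fun i => by
      conv_lhs => rw [← sum_inner_smul_e (g.symm (e i))]
      simp only [map_sum, map_smul, sum_inner, inner_sum, real_inner_smul_left,
        real_inner_smul_right, hw]
      rw [Finset.sum_comm]
      refine Finset.sum_congr rfl fun j _ => Finset.sum_congr rfl fun l _ => ?_
      rw [real_inner_comm (g (e l))]
      ring
  simp only [hexp]
  rw [Finset.sum_comm, Finset.mul_sum]
  refine Finset.sum_congr rfl fun j _ => ?_
  rw [Finset.sum_comm, Finset.sum_eq_single j]
  · rw [← Finset.sum_mul, ← Finset.mul_sum, sum_inner_mul_inner_e, hg, inner_e_e, if_pos rfl]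
    field_simp
  · intro l _ hl
    rw [← Finset.sum_mul, ← Finset.mul_sum, sum_inner_mul_inner_e, hg, inner_e_e,
      if_neg (Ne.symm hl)]
    ring
  · simp

end Conformal

lemma brP_act_idBlock (g : Pp n ≃L[ℝ] Pp n) (μ : Bil q n) (X Y : Pp n) :
    brP (act (idBlock g) μ) X Y = g (brP μ (g.symm X) (g.symm Y)) := rfl

lemma meanVec_act_idBlock {g : Pp n ≃L[ℝ] Pp n} {k : ℝ} (hk : k ≠ 0)
    (hg : ∀ X Y, ⟪g X, g Y⟫_ℝ = k * ⟪X, Y⟫_ℝ) (μ : Bil q n) :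
    meanVec (act (idBlock g) μ) = k⁻¹ • g (meanVec μ) := by
  refine ext_inner_right ℝ fun X => ?_
  rw [inner_meanVec, trace_ad_act, idBlock_symm, idBlock_inP, ← inner_meanVec, real_inner_smul_left]
  have := hg (meanVec μ) (g.symm X)
  rw [g.apply_symm_apply] at this
  rw [this, inv_mul_cancel_left₀ hk]

/-- Each inner product of outputs of `g` gives a factor `k`, each sum over the frame a factor `k⁻¹`,
and `H` is replaced by `k⁻¹ gH`; in every term the factors cancel. The scaling of the Ricci operator
reappears only when the form is converted with the inner product. -/
lemma ricForm_act_idBlock {g : Pp n ≃L[ℝ] Pp n} {k : ℝ} (hk : k ≠ 0)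
    (hg : ∀ X Y, ⟪g X, g Y⟫_ℝ = k * ⟪X, Y⟫_ℝ) (μ : Bil q n) (X Y : Pp n) :
    ricForm (act (idBlock g) μ) (g X) (g Y) = ricForm μ X Y := by
  unfold ricForm
  rw [meanVec_act_idBlock hk hg, killing_act, idBlock_symm, idBlock_inP, idBlock_inP]
  simp only [brP_act_idBlock, g.symm_apply_apply, hg, map_smul]
  have h1 := sum_inner_conformal hk hg (brBil μ X) (brBil μ Y)
  simp only [brBil_apply] at h1
  have h2 : ∑ i, ∑ j, k * ⟪brP μ (g.symm (e i)) (g.symm (e j)), X⟫_ℝ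
      * (k * ⟪brP μ (g.symm (e i)) (g.symm (e j)), Y⟫_ℝ)
      = ∑ i, ∑ j, ⟪brP μ (e i) (e j), X⟫_ℝ * ⟪brP μ (e i) (e j), Y⟫_ℝ := by
    have s1 : ∀ U, ∑ j, ⟪brP μ U (g.symm (e j)), X⟫_ℝ * ⟪brP μ U (g.symm (e j)), Y⟫_ℝ
        = k⁻¹ * ∑ j, ⟪brP μ U (e j), X⟫_ℝ * ⟪brP μ U (e j), Y⟫_ℝ := fun U => by
      have := sum_inner_conformal hk hg ((innerₗ (Pp n) X).comp (brBil μ U))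
        ((innerₗ (Pp n) Y).comp (brBil μ U))
      simpa [brBil_apply, real_inner_comm, mul_comm] using this
    have s2 : ∀ U, ∑ j, ⟪brP μ (g.symm (e j)) U, X⟫_ℝ * ⟪brP μ (g.symm (e j)) U, Y⟫_ℝ
        = k⁻¹ * ∑ j, ⟪brP μ (e j) U, X⟫_ℝ * ⟪brP μ (e j) U, Y⟫_ℝ := fun U => by
      have := sum_inner_conformal hk hg ((innerₗ (Pp n) X).comp ((brBil μ).flip U))
        ((innerₗ (Pp n) Y).comp ((brBil μ).flip U))
      simpa [brBil_apply, real_inner_comm, mul_comm] using this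
    simp only [mul_mul_mul_comm k, ← Finset.mul_sum, s1]
    rw [Finset.sum_comm]
    simp only [s2, ← Finset.mul_sum]
    rw [Finset.sum_comm]
    field_simp
  have h3 : ∀ U V : Pp n, brP μ (k⁻¹ • U) V = k⁻¹ • brP μ U V := fun U V => by
    simp only [← brBil_apply, map_smul, LinearMap.smul_apply]
  rw [h2]
  simp only [h3, real_inner_smul_left, real_inner_smul_right, ← Finset.mul_sum, h1]
  field_simp

/-! ### The isotropy representation -/

/-- The isotropy representation `Z ↦ ad_μ Z|_𝔭` of `𝔨`. -/
def isoRep (μ : Bil q n) : Kk q →ₗ[ℝ] Pp n →ₗ[ℝ] Pp n :=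
  LinearMap.mk₂ ℝ (fun Z X => (μ (inK Z) (inP X)).2)
    (fun X Y Z => by simp [inK_add]) (fun a X Y => by simp [inK_smul])
    (fun X Y Z => by simp [inP_add]) (fun a X Y => by simp [inP_smul])

/-- The bracket of `𝔨`. -/
def brK (μ : Bil q n) : Kk q →ₗ[ℝ] Kk q →ₗ[ℝ] Kk q :=
  LinearMap.mk₂ ℝ (fun Z W => (μ (inK Z) (inK W)).1)
    (fun X Y Z => by simp [inK_add]) (fun a X Y => by simp [inK_smul])
    (fun X Y Z => by simp [inK_add]) (fun a X Y => by simp [inK_smul])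

/-- Infinitesimal form of the independence of `∑ ⟪L e_i, M e_i⟫` from the orthonormal basis. The
matrix of `S` is antisymmetric, so the two double sums cancel after exchanging the indices. -/
lemma sum_inner_comp_skew {W : Type*} [NormedAddCommGroup W] [InnerProductSpace ℝ W]
    {S : Pp n →ₗ[ℝ] Pp n} (hS : ∀ X Y, ⟪S X, Y⟫_ℝ = -⟪X, S Y⟫_ℝ) (L M : Pp n →ₗ[ℝ] W) :
    ∑ i, (⟪L (S (e i)), M (e i)⟫_ℝ + ⟪L (e i), M (S (e i))⟫_ℝ) = 0 := by
  have h1 : ∀ i, ⟪L (S (e i)), M (e i)⟫_ℝ = ∑ j, ⟪e j, S (e i)⟫_ℝ * ⟪L (e j), M (e i)⟫_ℝ :=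
    fun i => by
      conv_lhs => rw [← sum_inner_smul_e (S (e i))]
      simp only [map_sum, map_smul, sum_inner, real_inner_smul_left]
  have h2 : ∀ i, ⟪L (e i), M (S (e i))⟫_ℝ = ∑ j, ⟪e j, S (e i)⟫_ℝ * ⟪L (e i), M (e j)⟫_ℝ :=
    fun i => by
      conv_lhs => rw [← sum_inner_smul_e (S (e i))]
      simp only [map_sum, map_smul, inner_sum, real_inner_smul_right]
  simp only [h1, h2]
  rw [Finset.sum_add_distrib]
  conv_lhs => enter [2]; rw [Finset.sum_comm]
  rw [← Finset.sum_add_distrib]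
  refine Finset.sum_eq_zero fun i _ => ?_
  rw [← Finset.sum_add_distrib]
  refine Finset.sum_eq_zero fun j _ => ?_
  rw [← real_inner_comm, hS]
  ring

lemma trace_prod_eq (f : Gg q n →ₗ[ℝ] Gg q n) :
    LinearMap.trace ℝ (Gg q n) f
      = LinearMap.trace ℝ (Kk q) (LinearMap.fst ℝ _ _ ∘ₗ f ∘ₗ LinearMap.inl ℝ _ _)
        + LinearMap.trace ℝ (Pp n) (LinearMap.snd ℝ _ _ ∘ₗ f ∘ₗ LinearMap.inr ℝ _ _) := by
  have h1 := LinearMap.trace_comp_comm' (LinearMap.inl ℝ (Kk q) (Pp n))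
    (LinearMap.fst ℝ (Kk q) (Pp n) ∘ₗ f)
  have h2 := LinearMap.trace_comp_comm' (LinearMap.inr ℝ (Kk q) (Pp n))
    (LinearMap.snd ℝ (Kk q) (Pp n) ∘ₗ f)
  rw [LinearMap.comp_assoc] at h1 h2
  rw [h1, h2, ← LinearMap.map_add]
  congr 1
  refine LinearMap.ext fun X => ?_
  exact (inK_add_inP (f X)).symm

namespace IsHomogeneous

variable {μ : Bil q n} (h : IsHomogeneous μ)
include h

lemma skewSymm (X Y : Gg q n) : μ X Y = -μ Y X := by
  have := h.alt (X + Y)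
  simp only [map_add, add_apply, h.alt, zero_add, add_zero] at this
  rw [eq_neg_iff_add_eq_zero, add_comm]; exact this

lemma bracket_bracket (X Y W : Gg q n) : μ (μ X Y) W = μ X (μ Y W) - μ Y (μ X W) := by
  have := h.jacobi X Y W
  rw [h.skewSymm W X, h.skewSymm W (μ X Y), map_neg] at this
  rw [← sub_eq_zero, ← neg_eq_zero, ← this]
  abel

lemma bracket_inK_inP (Z : Kk q) (X : Pp n) : μ (inK Z) (inP X) = inP (isoRep μ Z X) :=
  Prod.ext (h.kp Z X) rfl

lemma bracket_inP_inK (Z : Kk q) (X : Pp n) : μ (inP X) (inK Z) = -inP (isoRep μ Z X) := by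
  rw [h.skewSymm, h.bracket_inK_inP]

lemma bracket_inK_inK (Z W : Kk q) : μ (inK Z) (inK W) = inK (brK μ Z W) :=
  Prod.ext rfl (h.kk Z W)

lemma brP_skew (X Y : Pp n) : brP μ X Y = -brP μ Y X := congr(($(h.skewSymm (inP X) (inP Y))).2)

lemma brK_skew (X Y : Kk q) : brK μ X Y = -brK μ Y X := congr(($(h.skewSymm (inK X) (inK Y))).1)

lemma inner_isoRep (Z : Kk q) (X Y : Pp n) : ⟪isoRep μ Z X, Y⟫_ℝ = -⟪X, isoRep μ Z Y⟫_ℝ :=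
  h.skew Z X Y

lemma isoRep_brK (Z W : Kk q) (X : Pp n) :
    isoRep μ (brK μ Z W) X = isoRep μ Z (isoRep μ W X) - isoRep μ W (isoRep μ Z X) := by
  have := h.bracket_bracket (inK Z) (inK W) (inP X)
  simp only [h.bracket_inK_inK, h.bracket_inK_inP] at this
  exact congr(($this).2)

lemma isoRep_brP (Z : Kk q) (X Y : Pp n) :
    isoRep μ Z (brP μ X Y) = brP μ (isoRep μ Z X) Y + brP μ X (isoRep μ Z Y) := by
  have h1 := h.bracket_bracket (inK Z) (inP X) (inP Y)
  simp only [h.bracket_inK_inP] at h1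
  have h2 : (μ (inK Z) (μ (inP X) (inP Y))).2 = isoRep μ Z (brP μ X Y) := by
    rw [← inK_add_inP (μ (inP X) (inP Y)), map_add, h.bracket_inK_inK, h.bracket_inK_inP]
    exact zero_add _
  have h3 := congr(($h1).2)
  rw [Prod.snd_sub, h2] at h3
  change brP μ (isoRep μ Z X) Y = isoRep μ Z (brP μ X Y) - brP μ X (isoRep μ Z Y) at h3
  rw [h3, sub_add_cancel]

lemma isoRep_injective {Z : Kk q} (hZ : ∀ X, isoRep μ Z X = 0) : Z = 0 :=
  h.effective Z fun X => by rw [h.bracket_inK_inP, hZ]; rfl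

/-- `𝔨` is unimodular, being a subalgebra of `𝔰𝔬(𝔭)`. -/
lemma trace_brK (Z : Kk q) : LinearMap.trace ℝ (Kk q) (brK μ Z) = 0 := by
  -- `Q(W, W') = ∑ ⟪W e_i, W' e_i⟫` is the trace form of the isotropy representation: positive
  -- definite by effectiveness and invariant under `ad 𝔨`. Used as an isomorphism of `𝔨` with its
  -- dual, it conjugates `ad Z` to minus its transpose, which forces trace zero.
  let Q : Kk q →ₗ[ℝ] Module.Dual ℝ (Kk q) :=
    ∑ i, LinearMap.compl₁₂ (innerₗ (Pp n)) ((isoRep μ).flip (e i)) ((isoRep μ).flip (e i))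
  have hQ : ∀ W W', Q W W' = ∑ i, ⟪isoRep μ W (e i), isoRep μ W' (e i)⟫_ℝ := fun W W' => by
    simp [Q, LinearMap.sum_apply]
  have hinj : Function.Injective Q := by
    refine (injective_iff_map_eq_zero Q).2 fun W hW => h.isoRep_injective (Z := W) fun X => ?_
    have h0 : ∑ i, ⟪isoRep μ W (e i), isoRep μ W (e i)⟫_ℝ = 0 := by rw [← hQ, hW]; rfl
    rw [Finset.sum_eq_zero_iff_of_nonneg fun i _ => real_inner_self_nonneg] at h0
    rw [← sum_inner_smul_e X, map_sum]
    refine Finset.sum_eq_zero fun i hi => ?_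
    rw [map_smul, inner_self_eq_zero.1 (h0 i hi), smul_zero]
  have hskew : ∀ W W', Q (brK μ Z W) W' = -Q W (brK μ Z W') := fun W W' => by
    rw [eq_neg_iff_add_eq_zero, hQ, hQ, ← Finset.sum_add_distrib, ← neg_eq_zero,
      ← sum_inner_comp_skew (h.inner_isoRep Z) (isoRep μ W) (isoRep μ W'),
      ← Finset.sum_neg_distrib]
    refine Finset.sum_congr rfl fun i _ => ?_
    rw [h.isoRep_brK, h.isoRep_brK, inner_sub_left, inner_sub_right, h.inner_isoRep Z (isoRep μ W _)]
    ring
  let T := Q.linearEquivOfInjective hinj Subspace.dual_finrank_eq.symm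
  have hconj : T.conj (brK μ Z) = -Module.Dual.transpose (brK μ Z) := by
    refine LinearMap.ext fun φ => ?_
    obtain ⟨W, rfl⟩ := T.surjective φ
    refine LinearMap.ext fun W' => ?_
    rw [LinearEquiv.conj_apply_apply, T.symm_apply_apply]
    exact hskew W W'
  have h1 := LinearMap.trace_conj' (brK μ Z) T
  have h2 := LinearMap.map_neg (LinearMap.trace ℝ (Module.Dual ℝ (Kk q)))
    (Module.Dual.transpose (brK μ Z))
  rw [LinearMap.trace_transpose'] at h2
  have h3 := h2.symm.trans ((congr_arg _ hconj).symm.trans h1)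
  linarith

lemma trace_isoRep (Z : Kk q) : LinearMap.trace ℝ (Pp n) (isoRep μ Z) = 0 := by
  rw [trace_eq_sum_inner_e]
  refine Finset.sum_eq_zero fun i _ => ?_
  have := h.inner_isoRep Z (e i) (e i)
  rw [real_inner_comm] at this
  linarith

lemma trace_ad_inK (Z : Kk q) : LinearMap.trace ℝ (Gg q n) (ad μ (inK Z)).toLinearMap = 0 := by
  rw [trace_prod_eq]
  exact (congr_arg₂ (· + ·) (h.trace_brK Z) (h.trace_isoRep Z)).trans (add_zero 0)

/-- The functional `X ↦ tr ad X` vanishes on brackets, and the isotropy representation is skew. -/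
lemma isoRep_meanVec (Z : Kk q) : isoRep μ Z (meanVec μ) = 0 := by
  refine ext_inner_right ℝ fun X => ?_
  rw [h.inner_isoRep, inner_meanVec, ← h.bracket_inK_inP, inner_zero_left, neg_eq_zero]
  have : (ad μ (μ (inK Z) (inP X))).toLinearMap
      = (ad μ (inK Z)).toLinearMap ∘ₗ (ad μ (inP X)).toLinearMap
        - (ad μ (inP X)).toLinearMap ∘ₗ (ad μ (inK Z)).toLinearMap :=
    LinearMap.ext fun W => h.bracket_bracket _ _ W
  rw [this, map_sub, LinearMap.trace_comp_comm', sub_self]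

lemma killing_inK_inP (Z : Kk q) (X : Pp n) :
    killing μ (inK Z) (inP X) = LinearMap.trace ℝ (Pp n) (isoRep μ Z ∘ₗ brBil μ X) := by
  rw [killing, trace_prod_eq]
  have h1 : LinearMap.fst ℝ _ _ ∘ₗ ((ad μ (inK Z)).comp (ad μ (inP X))).toLinearMap
      ∘ₗ LinearMap.inl ℝ (Kk q) (Pp n) = 0 := LinearMap.ext fun W => by
    change (μ (inK Z) (μ (inP X) (inK W))).1 = 0
    rw [h.bracket_inP_inK, map_neg, h.bracket_inK_inP]
    exact neg_zero
  have h2 : LinearMap.snd ℝ _ _ ∘ₗ ((ad μ (inK Z)).comp (ad μ (inP X))).toLinearMap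
      ∘ₗ LinearMap.inr ℝ (Kk q) (Pp n) = isoRep μ Z ∘ₗ brBil μ X := LinearMap.ext fun W => by
    change (μ (inK Z) (μ (inP X) (inP W))).2 = isoRep μ Z (brP μ X W)
    rw [← inK_add_inP (μ (inP X) (inP W)), map_add, h.bracket_inK_inK, h.bracket_inK_inP]
    exact zero_add _
  rw [h1, h2, map_zero, zero_add]

lemma killing_inK_inK (Z W : Kk q) :
    killing μ (inK Z) (inK W) = LinearMap.trace ℝ (Kk q) (brK μ Z ∘ₗ brK μ W)
      + LinearMap.trace ℝ (Pp n) (isoRep μ Z ∘ₗ isoRep μ W) := by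
  rw [killing, trace_prod_eq]
  congr 2
  · refine LinearMap.ext fun U => ?_
    change (μ (inK Z) (μ (inK W) (inK U))).1 = _
    rw [h.bracket_inK_inK, h.bracket_inK_inK]
    rfl
  · refine LinearMap.ext fun U => ?_
    change (μ (inK Z) (μ (inK W) (inP U))).2 = _
    rw [h.bracket_inK_inP, h.bracket_inK_inP]
    rfl

end IsHomogeneous

/-! ### Change of the reductive complement -/

/-- The `𝔨`-component of the restriction of `u` to `𝔭`. -/
def kpBlock (u : Gg q n ≃L[ℝ] Gg q n) : Pp n →ₗ[ℝ] Kk q :=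
  LinearMap.fst ℝ _ _ ∘ₗ u.toLinearEquiv.toLinearMap ∘ₗ LinearMap.inr ℝ (Kk q) (Pp n)

namespace IsHomogeneous

variable {μ : Bil q n} (h : IsHomogeneous μ) {u : Gg q n ≃L[ℝ] Gg q n}
  (hu : ∀ Z, u (inK Z) = inK Z) (hu' : ∀ X, (u X).2 = X.2)
  (hkp : ∀ Z X, (act u μ (inK Z) (inP X)).1 = 0)

section

include hu hu'

-- The hypotheses `hu`, `hu'` say `u = [I β; 0 I]` with `β = kpBlock u`. Thus `u · μ` is `μ` seen
-- from the complement of the vectors `X - βX`.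
omit h in
lemma _root_.BracketFlow.unipotent_symm_inP (X : Pp n) : u.symm (inP X) = inP X - inK (kpBlock u X) := by
  rw [ContinuousLinearEquiv.symm_apply_eq, map_sub, hu]
  have : u (inP X) = inK (kpBlock u X) + inP X :=
    (inK_add_inP (u (inP X))).symm.trans (by rw [hu']; rfl)
  rw [this, add_sub_cancel_left]

include h

include hkp in
/-- The new complement is invariant under the isotropy representation. -/
lemma brK_kpBlock (Z : Kk q) (X : Pp n) :
    brK μ Z (kpBlock u X) = kpBlock u (isoRep μ Z X) := by
  have h1 := hkp Z X
  rw [act_apply, symm_inK hu, unipotent_symm_inP hu hu', map_sub, h.bracket_inK_inP,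
    h.bracket_inK_inK, map_sub, hu] at h1
  exact (sub_eq_zero.1 h1).symm

lemma brP_unipotent (X Y : Pp n) :
    brP (act u μ) X Y = brP μ X Y - isoRep μ (kpBlock u X) Y + isoRep μ (kpBlock u Y) X := by
  rw [brP, act_apply, hu', unipotent_symm_inP hu hu', unipotent_symm_inP hu hu']
  simp only [map_sub, sub_apply, h.bracket_inK_inP, h.bracket_inP_inK, h.bracket_inK_inK]
  rw [Prod.snd_sub, Prod.snd_sub, Prod.snd_sub, Prod.snd_neg]
  change brP μ X Y - _ - (-_ - 0) = _
  simp only [inP]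
  abel

/-- The correction is the trace of `ad (βX)`, which is zero: `𝔨` is unimodular and acts on `𝔭` by
skew maps. -/
lemma meanVec_unipotent : meanVec (act u μ) = meanVec μ := by
  refine ext_inner_right ℝ fun X => ?_
  rw [inner_meanVec, trace_ad_act, unipotent_symm_inP hu hu', inner_meanVec]
  have : (ad μ (inP X - inK (kpBlock u X))).toLinearMap
      = (ad μ (inP X)).toLinearMap - (ad μ (inK (kpBlock u X))).toLinearMap := by
    unfold ad
    rw [map_sub]
    rfl
  rw [this, LinearMap.map_sub, h.trace_ad_inK, sub_zero]

lemma killing_unipotent (X : Pp n) :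
    killing (act u μ) (inP X) (inP X) = killing μ (inP X) (inP X)
      - 2 * LinearMap.trace ℝ (Pp n) (isoRep μ (kpBlock u X) ∘ₗ brBil μ X)
      + LinearMap.trace ℝ (Kk q) (brK μ (kpBlock u X) ∘ₗ brK μ (kpBlock u X))
      + LinearMap.trace ℝ (Pp n) (isoRep μ (kpBlock u X) ∘ₗ isoRep μ (kpBlock u X)) := by
  have hs : (inP X - inK (kpBlock u X) : Gg q n) = inP X + (-1 : ℝ) • inK (kpBlock u X) := by
    rw [neg_one_smul, sub_eq_add_neg]
  rw [killing_act, unipotent_symm_inP hu hu', hs, killing_add_left, killing_smul_left,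
    killing_comm μ (inP X), killing_add_left, killing_smul_left,
    killing_comm μ (inK (kpBlock u X)) (inP X + _), killing_add_left, killing_smul_left,
    killing_comm μ (inP X) (inK _), h.killing_inK_inK, h.killing_inK_inP]
  ring

include hkp

/-- Cyclicity moves the trace to `𝔨`, where equivariance of `β` turns `Z ↦ β(Z·Y)` into `-ad (βY)`,
which is traceless by unimodularity. -/
lemma trace_kpBlock (Y : Pp n) :
    LinearMap.trace ℝ (Pp n) ((isoRep μ).flip Y ∘ₗ kpBlock u) = 0 := by
  have : kpBlock u ∘ₗ (isoRep μ).flip Y = -brK μ (kpBlock u Y) := LinearMap.ext fun Z => by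
    change kpBlock u (isoRep μ Z Y) = -brK μ (kpBlock u Y) Z
    rw [← h.brK_kpBlock hu hu' hkp, h.brK_skew]
  rw [LinearMap.trace_comp_comm', this, LinearMap.map_neg, h.trace_brK, neg_zero]

/-- The same passage from `𝔭` to `𝔨`, applied to the square: the two signs of `-ad (βY)` cancel. -/
lemma trace_kpBlock_sq (Y : Pp n) :
    LinearMap.trace ℝ (Pp n)
        (((isoRep μ).flip Y ∘ₗ kpBlock u) ∘ₗ ((isoRep μ).flip Y ∘ₗ kpBlock u))
      = LinearMap.trace ℝ (Kk q) (brK μ (kpBlock u Y) ∘ₗ brK μ (kpBlock u Y)) := by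
  have : kpBlock u ∘ₗ (isoRep μ).flip Y = -brK μ (kpBlock u Y) := LinearMap.ext fun Z => by
    change kpBlock u (isoRep μ Z Y) = -brK μ (kpBlock u Y) Z
    rw [← h.brK_kpBlock hu hu' hkp, h.brK_skew]
  rw [LinearMap.comp_assoc, LinearMap.trace_comp_comm', LinearMap.comp_assoc, LinearMap.comp_assoc,
    this]
  have h2 : kpBlock u ∘ₗ (isoRep μ).flip Y ∘ₗ (-brK μ (kpBlock u Y))
      = brK μ (kpBlock u Y) ∘ₗ brK μ (kpBlock u Y) := LinearMap.ext fun Z => by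
    have := congr($this (-brK μ (kpBlock u Y) Z))
    change kpBlock u ((isoRep μ).flip Y (-brK μ (kpBlock u Y) Z)) = _
    refine this.trans ?_
    simp
  rw [h2]

lemma isoRep_kpBlock_self (Y X : Pp n) :
    isoRep μ (kpBlock u (isoRep μ (kpBlock u X) Y)) Y
      = -isoRep μ (kpBlock u (isoRep μ (kpBlock u Y) X)) Y := by
  rw [← h.brK_kpBlock hu hu' hkp, ← h.brK_kpBlock hu hu' hkp, h.brK_skew, map_neg]
  rfl

/-- Pairing with `Y` gives, by skewness of the isotropy, minus the trace computed in
`trace_kpBlock`. -/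
lemma sum_isoRep_kpBlock : ∑ i, isoRep μ (kpBlock u (e i)) (e i) = 0 := by
  refine ext_inner_right ℝ fun Y => ?_
  have h1 := h.trace_kpBlock hu hu' hkp Y
  rw [trace_eq_sum_inner_e] at h1
  rw [inner_zero_left, sum_inner, ← neg_eq_zero, ← h1, ← Finset.sum_neg_distrib]
  refine Finset.sum_congr rfl fun i _ => ?_
  rw [h.inner_isoRep, neg_neg]
  rfl

/-- The Ricci form does not depend on the reductive complement. -/
lemma ricForm_unipotent_self (X : Pp n) : ricForm (act u μ) X X = ricForm μ X X := by
  set β := kpBlock u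
  -- The new value of `μ_𝔭(X, e_i)` is `a i - s i + t i`. The remaining task is to see that all
  -- terms other than those of `μ` cancel between the two norm sums and the Killing form.
  set a : Fin n → Pp n := fun i => brP μ X (e i)
  set s : Fin n → Pp n := fun i => isoRep μ (β X) (e i)
  set t : Fin n → Pp n := fun i => isoRep μ (β (e i)) X
  set C : Fin n → Fin n → ℝ := fun i j => ⟪brP μ (e i) (e j), X⟫_ℝ
  have hC : ∀ i j, C i j = -C j i := fun i j => by
    simp only [C]
    rw [h.brP_skew, inner_neg_left]
  have term1 : ∑ i, ⟪brP (act u μ) X (e i), brP (act u μ) X (e i)⟫_ℝ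
      = ∑ i, ⟪a i, a i⟫_ℝ + ∑ i, ⟪s i, s i⟫_ℝ + ∑ i, ⟪t i, t i⟫_ℝ - 2 * ∑ i, ⟪s i, a i⟫_ℝ
        + 2 * ∑ i, ⟪a i, t i⟫_ℝ - 2 * ∑ i, ⟪s i, t i⟫_ℝ := by
    simp only [Finset.mul_sum, ← Finset.sum_add_distrib, ← Finset.sum_sub_distrib]
    refine Finset.sum_congr rfl fun i _ => ?_
    rw [h.brP_unipotent hu hu']
    change ⟪a i - s i + t i, a i - s i + t i⟫_ℝ = _
    simp only [inner_add_left, inner_add_right, inner_sub_left, inner_sub_right,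
      real_inner_comm (s i) (a i), real_inner_comm (t i) (a i), real_inner_comm (t i) (s i)]
    ring
  have hbr : ∀ i j, ⟪brP (act u μ) (e i) (e j), X⟫_ℝ = C i j + ⟪e j, t i⟫_ℝ - ⟪e i, t j⟫_ℝ :=
    fun i j => by
      rw [h.brP_unipotent hu hu', inner_add_left, inner_sub_left, h.inner_isoRep,
        h.inner_isoRep (kpBlock u (e j))]
      ring
  have term2 : ∑ i, ∑ j, ⟪brP (act u μ) (e i) (e j), X⟫_ℝ * ⟪brP (act u μ) (e i) (e j), X⟫_ℝ
      = ∑ i, ∑ j, C i j * C i j + 4 * ∑ i, ∑ j, C i j * ⟪e j, t i⟫_ℝ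
        + 2 * ∑ i, ∑ j, ⟪e j, t i⟫_ℝ * ⟪e j, t i⟫_ℝ
        - 2 * ∑ i, ∑ j, ⟪e j, t i⟫_ℝ * ⟪e i, t j⟫_ℝ := by
    have s1 : ∑ i, ∑ j, C i j * ⟪e i, t j⟫_ℝ = -∑ i, ∑ j, C i j * ⟪e j, t i⟫_ℝ := by
      rw [Finset.sum_comm]
      simp only [← Finset.sum_neg_distrib]
      refine Finset.sum_congr rfl fun i _ => Finset.sum_congr rfl fun j _ => ?_
      rw [hC j i]
      ring
    have s2 : ∑ i, ∑ j, ⟪e i, t j⟫_ℝ * ⟪e i, t j⟫_ℝ = ∑ i, ∑ j, ⟪e j, t i⟫_ℝ * ⟪e j, t i⟫_ℝ :=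
      Finset.sum_comm
    have s3 : ∑ i, ∑ j, ⟪brP (act u μ) (e i) (e j), X⟫_ℝ * ⟪brP (act u μ) (e i) (e j), X⟫_ℝ
        = ∑ i, ∑ j, C i j * C i j + 2 * ∑ i, ∑ j, C i j * ⟪e j, t i⟫_ℝ
        - 2 * ∑ i, ∑ j, C i j * ⟪e i, t j⟫_ℝ
        + ∑ i, ∑ j, ⟪e j, t i⟫_ℝ * ⟪e j, t i⟫_ℝ + ∑ i, ∑ j, ⟪e i, t j⟫_ℝ * ⟪e i, t j⟫_ℝ
        - 2 * ∑ i, ∑ j, ⟪e j, t i⟫_ℝ * ⟪e i, t j⟫_ℝ := by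
      simp only [Finset.mul_sum, ← Finset.sum_add_distrib, ← Finset.sum_sub_distrib]
      refine Finset.sum_congr rfl fun i _ => Finset.sum_congr rfl fun j _ => ?_
      rw [hbr]
      ring
    rw [s3, s1, s2]
    ring
  have hT : ∑ i, ∑ j, ⟪e j, t i⟫_ℝ * ⟪e j, t i⟫_ℝ = ∑ i, ⟪t i, t i⟫_ℝ := by
    refine Finset.sum_congr rfl fun i _ => ?_
    rw [← sum_inner_mul_inner_e (t i) (t i)]
    exact Finset.sum_congr rfl fun j _ => by rw [real_inner_comm (t i)]
  have hP : ∑ i, ∑ j, C i j * ⟪e j, t i⟫_ℝ = ∑ i, ⟪brP μ (e i) (t i), X⟫_ℝ := by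
    refine Finset.sum_congr rfl fun i _ => ?_
    conv_rhs => rw [← brBil_apply, ← sum_inner_smul_e (t i)]
    simp only [map_sum, map_smul, sum_inner, real_inner_smul_left, brBil_apply]
    exact Finset.sum_congr rfl fun j _ => mul_comm _ _
  -- the trace of the square of `Y ↦ ad (β Y) X`
  set T : Pp n →ₗ[ℝ] Pp n := (isoRep μ).flip X ∘ₗ β
  have hTe : ∀ i, T (e i) = t i := fun i => rfl
  have hτ : ∑ i, ∑ j, ⟪e j, t i⟫_ℝ * ⟪e i, t j⟫_ℝ = LinearMap.trace ℝ (Pp n) (T ∘ₗ T) := by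
    rw [trace_eq_sum_inner_e]
    refine Finset.sum_congr rfl fun i _ => ?_
    change _ = ⟪e i, T (t i)⟫_ℝ
    conv_rhs => rw [← sum_inner_smul_e (t i)]
    simp only [map_sum, map_smul, inner_sum, real_inner_smul_right, hTe]
  -- Equivariance of `β` and antisymmetry of the bracket of `𝔨` replace one factor `T` by `-ad (βX)`
  -- on `𝔭`. The mixed term `⟪s, t⟫` is therefore the same trace that comes from the second norm sum
  -- and from the `𝔨`-part of the Killing form.
  have hst : LinearMap.trace ℝ (Pp n) (T ∘ₗ T) = ∑ i, ⟪s i, t i⟫_ℝ := by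
    have e1 : T ∘ₗ T = -(T ∘ₗ isoRep μ (β X)) :=
      LinearMap.ext fun Y => h.isoRep_kpBlock_self hu hu' hkp X Y
    rw [e1, LinearMap.map_neg, LinearMap.trace_comp_comm', trace_eq_sum_inner_e,
      ← Finset.sum_neg_distrib]
    refine Finset.sum_congr rfl fun i _ => ?_
    rw [h.inner_isoRep]
    rfl
  have hκ := h.trace_kpBlock_sq hu hu' hkp X
  change LinearMap.trace ℝ (Pp n) (T ∘ₗ T) = _ at hκ
  have hsa : LinearMap.trace ℝ (Pp n) (isoRep μ (β X) ∘ₗ brBil μ X) = -∑ i, ⟪s i, a i⟫_ℝ := by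
    rw [trace_eq_sum_inner_e, ← Finset.sum_neg_distrib]
    exact Finset.sum_congr rfl fun i _ => by rw [h.inner_isoRep, neg_neg]; rfl
  have hss : LinearMap.trace ℝ (Pp n) (isoRep μ (β X) ∘ₗ isoRep μ (β X))
      = -∑ i, ⟪s i, s i⟫_ℝ := by
    rw [trace_eq_sum_inner_e, ← Finset.sum_neg_distrib]
    exact Finset.sum_congr rfl fun i _ => by rw [h.inner_isoRep, neg_neg]; rfl
  -- `ad (β e_i)` is skew and acts as a derivation of `μ_𝔭`; the extra term of the Leibniz rule
  -- contains `∑ β(e_i)·e_i = 0`.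
  have hat : ∑ i, ⟪a i, t i⟫_ℝ = ∑ i, ⟪brP μ (e i) (t i), X⟫_ℝ := by
    have e1 : ∀ i, ⟪a i, t i⟫_ℝ = ⟪brP μ (e i) (t i), X⟫_ℝ
        - ⟪brBil μ X (isoRep μ (β (e i)) (e i)), X⟫_ℝ := fun i => by
      have := h.inner_isoRep (β (e i)) (a i) X
      change _ = -⟪a i, t i⟫_ℝ at this
      rw [← neg_eq_iff_eq_neg.2 this, h.isoRep_brP, inner_add_left, h.brP_skew (e i), inner_neg_left,
        brBil_apply]
      ring
    have e2 : ∑ i, ⟪brBil μ X (isoRep μ (β (e i)) (e i)), X⟫_ℝ = 0 := by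
      rw [← sum_inner, ← map_sum, h.sum_isoRep_kpBlock hu hu' hkp, map_zero, inner_zero_left]
    simp only [e1]
    rw [Finset.sum_sub_distrib, e2, sub_zero]
  have hH : ⟪brP (act u μ) (meanVec (act u μ)) X, X⟫_ℝ = ⟪brP μ (meanVec μ) X, X⟫_ℝ := by
    rw [h.meanVec_unipotent hu hu', h.brP_unipotent hu hu', h.isoRep_meanVec, add_zero,
      inner_sub_left, sub_eq_self]
    have := h.inner_isoRep (kpBlock u (meanVec μ)) X X
    rw [real_inner_comm X] at this
    rw [real_inner_comm]
    linarith
  unfold ricForm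
  rw [term1, term2, hT, hP, hτ, h.killing_unipotent hu hu', hsa, hss, ← hκ, hst,
    real_inner_comm _ X, hH, hat, real_inner_comm (brP μ (meanVec μ) X) X]
  ring

lemma ricForm_unipotent (X Y : Pp n) : ricForm (act u μ) X Y = ricForm μ X Y := by
  have h0 := h.ricForm_unipotent_self hu hu' hkp (X + Y)
  have polar : ∀ ν : Bil q n, ricForm ν (X + Y) (X + Y)
      = ricForm ν X X + 2 * ricForm ν X Y + ricForm ν Y Y := fun ν => by
    rw [ricForm_add_left, ricForm_comm ν X (X + Y), ricForm_comm ν Y (X + Y), ricForm_add_left,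
      ricForm_add_left, ricForm_comm ν Y X]
    ring
  rw [polar, polar, h.ricForm_unipotent_self hu hu' hkp, h.ricForm_unipotent_self hu hu' hkp] at h0
  linarith

end

end IsHomogeneous

/-! ### Orthogonal maps and homotheties of `𝔭` -/

lemma adjoint_skewPart (B : Pp n →L[ℝ] Pp n) :
    ContinuousLinearMap.adjoint (skewPart B) = -skewPart B := by
  refine ContinuousLinearMap.ext fun X => ext_inner_right ℝ fun Y => ?_
  rw [ContinuousLinearMap.adjoint_inner_left]
  change ⟪X, (1 / 2 : ℝ) • (B Y - ContinuousLinearMap.adjoint B Y)⟫_ℝ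
    = ⟪-((1 / 2 : ℝ) • (B X - ContinuousLinearMap.adjoint B X)), Y⟫_ℝ
  simp only [real_inner_smul_left, real_inner_smul_right, inner_sub_left, inner_sub_right,
    inner_neg_left, ContinuousLinearMap.adjoint_inner_left, ContinuousLinearMap.adjoint_inner_right]
  ring

lemma inner_exp_skewPart (B : Pp n →L[ℝ] Pp n) (t : ℝ) (X Y : Pp n) :
    ⟪expGL (t • skewPart B) X, expGL (t • skewPart B) Y⟫_ℝ = ⟪X, Y⟫_ℝ := by
  let : NormedAlgebra ℚ (Pp n →L[ℝ] Pp n) := .restrictScalars ℚ ℝ _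
  have h1 : ContinuousLinearMap.adjoint (NormedSpace.exp (t • skewPart B))
      = NormedSpace.exp (-(t • skewPart B)) := by
    rw [← ContinuousLinearMap.star_eq_adjoint, NormedSpace.star_exp,
      ContinuousLinearMap.star_eq_adjoint]
    congr 1
    rw [map_smulₛₗ, adjoint_skewPart]
    simp
  change ⟪NormedSpace.exp (t • skewPart B) X, NormedSpace.exp (t • skewPart B) Y⟫_ℝ = _
  rw [← ContinuousLinearMap.adjoint_inner_right, h1]
  exact congr(⟪X, $(exp_neg_mul_exp (t • skewPart B)) Y⟫_ℝ)

/-- The homothety of `𝔭` of ratio `e^{-x}`. -/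
def homothety (x : ℝ) : Pp n ≃L[ℝ] Pp n :=
  ContinuousLinearEquiv.equivOfInverse (Real.exp (-x) • ContinuousLinearMap.id ℝ (Pp n))
    (Real.exp x • ContinuousLinearMap.id ℝ (Pp n))
    (fun X => by simp [smul_smul, ← Real.exp_add]) (fun X => by simp [smul_smul, ← Real.exp_add])

lemma homothety_apply (x : ℝ) (X : Pp n) : homothety x X = Real.exp (-x) • X := rfl

lemma homothety_symm_apply (x : ℝ) (X : Pp n) : (homothety x).symm X = Real.exp x • X := rfl

lemma homothety_zero : (homothety 0 : Pp n ≃L[ℝ] Pp n) = 1 :=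
  ContinuousLinearEquiv.ext (funext fun X => by rw [homothety_apply, neg_zero, Real.exp_zero, one_smul]; rfl)

lemma IsHomogeneous.scale_exp {μ : Bil q n} (h : IsHomogeneous μ) (x : ℝ) :
    scale (Real.exp x) μ = act (idBlock (homothety x)) μ :=
  scale_eq_act h.alt h.kk h.kp (fun X => by rw [homothety_apply, Real.exp_neg])
    (homothety_symm_apply x) (Real.exp_pos x).ne'

/-! ### Curves of block matrices -/

lemma hasDerivAt_idBlock {g : ℝ → Pp n ≃L[ℝ] Pp n} {g' : Pp n →L[ℝ] Pp n} {t : ℝ}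
    (h : HasDerivAt (fun s => (g s : Pp n →L[ℝ] Pp n)) g' t) :
    HasDerivAt (fun s => ((idBlock (g s) : Gg q n ≃L[ℝ] Gg q n) : Gg q n →L[ℝ] Gg q n))
      (zeroBlock g') t := by
  have h1 := (((hasDerivAt_const t (ContinuousLinearMap.inr ℝ (Kk q) (Pp n))).clm_comp h).clm_comp
    (hasDerivAt_const t (ContinuousLinearMap.snd ℝ (Kk q) (Pp n)))).const_add
    ((ContinuousLinearMap.inl ℝ (Kk q) (Pp n)).comp (ContinuousLinearMap.fst ℝ (Kk q) (Pp n)))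
  have h2 : (fun s => ((idBlock (g s) : Gg q n ≃L[ℝ] Gg q n) : Gg q n →L[ℝ] Gg q n)) = fun s =>
      ContinuousLinearMap.inl ℝ (Kk q) (Pp n) ∘L ContinuousLinearMap.fst ℝ (Kk q) (Pp n)
        + (ContinuousLinearMap.inr ℝ (Kk q) (Pp n) ∘L (g s : Pp n →L[ℝ] Pp n))
          ∘L ContinuousLinearMap.snd ℝ (Kk q) (Pp n) :=
    funext fun s => ContinuousLinearMap.ext fun X => (inK_add_inP (idBlock (g s) X)).symm
  rw [h2]
  refine h1.congr_deriv (ContinuousLinearMap.ext fun X => ?_)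
  simp only [zeroBlock, zero_add, add_zero, ContinuousLinearMap.zero_comp,
    ContinuousLinearMap.comp_zero]
  rfl

lemma hasDerivAt_act_idBlock {g : ℝ → Pp n ≃L[ℝ] Pp n} {E : Pp n →L[ℝ] Pp n} {t : ℝ}
    (h : HasDerivAt (fun s => (g s : Pp n →L[ℝ] Pp n)) (E ∘L (g t : Pp n →L[ℝ] Pp n)) t)
    (h' : HasDerivAt (fun s => ((g s).symm : Pp n →L[ℝ] Pp n))
      (-(((g t).symm : Pp n →L[ℝ] Pp n) ∘L E)) t) (μ : Bil q n) :
    HasDerivAt (fun s => act (idBlock (g s)) μ) (piRep (zeroBlock E) (act (idBlock (g t)) μ)) t := by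
  refine hasDerivAt_act (G := fun s => idBlock (g s)) ?_ ?_ μ
  · refine (hasDerivAt_idBlock h).congr_deriv (ContinuousLinearMap.ext fun X => ?_)
    rfl
  · refine (hasDerivAt_idBlock h').congr_deriv (ContinuousLinearMap.ext fun X => ?_)
    change ((0, -((g t).symm (E X.2))) : Gg q n) = -(0, (g t).symm (E X.2))
    rw [Prod.neg_mk, neg_zero]

lemma piRep_zeroBlock_neg (E : Pp n →L[ℝ] Pp n) (μ : Bil q n) :
    piRep (zeroBlock (-E)) μ = -piRep (zeroBlock E) μ := by
  have h : ∀ X : Gg q n, zeroBlock (-E) X = -zeroBlock E X := fun X => by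
    change ((0, -E X.2) : Gg q n) = -(0, E X.2)
    rw [Prod.neg_mk, neg_zero]
  refine bil_ext fun X Y => ?_
  simp only [neg_apply, piRep_apply, map_neg, h]
  abel

/-! ### The curve of a soliton -/

/-- The operators `e^{tA} e^{-tB}`, where `A` is the skew-symmetric part of `B`. -/
def frame (B : Pp n →L[ℝ] Pp n) (t : ℝ) : Pp n ≃L[ℝ] Pp n :=
  expGL (t • skewPart B) * expGL (-(t • B))

lemma solitonCurve_eq (D : Gg q n →L[ℝ] Gg q n) (μ : Bil q n) (t : ℝ) :
    solitonCurve D μ t = act (idBlock (frame (pBlock D) t)) μ := rfl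

/-- The symmetric part `½ (B + Bᵗ)`. -/
def symPart (B : Pp n →L[ℝ] Pp n) : Pp n →L[ℝ] Pp n :=
  (1 / 2 : ℝ) • (B + ContinuousLinearMap.adjoint B)

lemma symPart_add_skewPart (B : Pp n →L[ℝ] Pp n) : symPart B + skewPart B = B := by
  refine ContinuousLinearMap.ext fun X => ?_
  change (1 / 2 : ℝ) • (B X + ContinuousLinearMap.adjoint B X)
    + (1 / 2 : ℝ) • (B X - ContinuousLinearMap.adjoint B X) = B X
  module

/-- The operator `e^{tA} S e^{-tA}`, where `A` and `S` are the skew-symmetric and the symmetric part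
of `B`. -/
def rotated (B : Pp n →L[ℝ] Pp n) (t : ℝ) : Pp n →L[ℝ] Pp n :=
  (expGL (t • skewPart B) : Pp n →L[ℝ] Pp n) ∘L symPart B ∘L
    ((expGL (t • skewPart B)).symm : Pp n →L[ℝ] Pp n)

/-- The left factor contributes `A` and the right one `-B`, both in the middle of the product; `A -
B = -S` leaves only the symmetric part, conjugated by `e^{tA}`. -/
lemma hasDerivAt_frame (B : Pp n →L[ℝ] Pp n) (t : ℝ) :
    HasDerivAt (fun s => (frame B s : Pp n →L[ℝ] Pp n))
      (-(rotated B t ∘L (frame B t : Pp n →L[ℝ] Pp n))) t := by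
  refine ((hasDerivAt_exp_smul (skewPart B) t).clm_comp
    (hasDerivAt_exp_neg_smul' B t)).congr_deriv (ContinuousLinearMap.ext fun X => ?_)
  change NormedSpace.exp (t • skewPart B) (skewPart B (NormedSpace.exp (-(t • B)) X))
      + NormedSpace.exp (t • skewPart B) (-(B (NormedSpace.exp (-(t • B)) X)))
    = -(expGL (t • skewPart B) (symPart B ((expGL (t • skewPart B)).symm
      (expGL (t • skewPart B) (expGL (-(t • B)) X)))))
  rw [ContinuousLinearEquiv.symm_apply_apply]
  change _ = -(NormedSpace.exp (t • skewPart B) (symPart B (NormedSpace.exp (-(t • B)) X)))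
  have h1 : ∀ Y, B Y = symPart B Y + skewPart B Y := fun Y =>
    congr($(symPart_add_skewPart B) Y).symm
  rw [h1, map_neg, map_add]
  abel

lemma hasDerivAt_frame_symm (B : Pp n →L[ℝ] Pp n) (t : ℝ) :
    HasDerivAt (fun s => ((frame B s).symm : Pp n →L[ℝ] Pp n))
      (((frame B t).symm : Pp n →L[ℝ] Pp n) ∘L rotated B t) t := by
  have hsymm : ∀ s : ℝ, ((frame B s).symm : Pp n →L[ℝ] Pp n)
      = NormedSpace.exp (s • B) ∘L NormedSpace.exp (-(s • skewPart B)) := fun s => by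
    refine ContinuousLinearMap.ext fun X => ?_
    change (expGL (-(s • B))).symm ((expGL (s • skewPart B)).symm X) = _
    rw [expGL_symm, expGL_symm, neg_neg]
    rfl
  simp only [hsymm]
  refine ((hasDerivAt_exp_smul B t).clm_comp
    (hasDerivAt_exp_neg_smul' (skewPart B) t)).congr_deriv (ContinuousLinearMap.ext fun X => ?_)
  have h1 : rotated B t X = NormedSpace.exp (t • skewPart B)
      (symPart B (NormedSpace.exp (-(t • skewPart B)) X)) := by
    change expGL _ (symPart B ((expGL (t • skewPart B)).symm X)) = _
    rw [expGL_symm]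
    rfl
  have h2 : ∀ Y, NormedSpace.exp (-(t • skewPart B)) (NormedSpace.exp (t • skewPart B) Y) = Y :=
    fun Y => congr($(exp_neg_mul_exp (t • skewPart B)) Y)
  simp only [ContinuousLinearMap.comp_apply, h1, h2, add_apply, neg_apply,
    mul_apply_eq_comp]
  have h3 : ∀ Y, B Y = symPart B Y + skewPart B Y := fun Y =>
    congr($(symPart_add_skewPart B) Y).symm
  rw [h3, map_add, map_neg]
  abel

lemma hasDerivAt_homothety_frame {B : Pp n →L[ℝ] Pp n} {α τ : ℝ → ℝ} {α' τ' t : ℝ}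
    (hα : HasDerivAt α α' t) (hτ : HasDerivAt τ τ' t) (μ : Bil q n) :
    HasDerivAt (fun s => act (idBlock (homothety (α s) * frame B (τ s))) μ)
      (piRep (zeroBlock (-(α' • ContinuousLinearMap.id ℝ (Pp n) + τ' • rotated B (τ t))))
        (act (idBlock (homothety (α t) * frame B (τ t))) μ)) t := by
  refine hasDerivAt_act_idBlock (g := fun s => homothety (α s) * frame B (τ s)) ?_ ?_ μ
  · have h1 := hα.neg.exp.smul ((hasDerivAt_frame B (τ t)).scomp t hτ)
    refine h1.congr_deriv (ContinuousLinearMap.ext fun X => ?_)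
    change Real.exp (-α t) • τ' • -(rotated B (τ t) (frame B (τ t) X))
        + (Real.exp (-α t) * -α') • frame B (τ t) X
      = -(α' • (Real.exp (-α t) • frame B (τ t) X)
        + τ' • rotated B (τ t) (Real.exp (-α t) • frame B (τ t) X))
    rw [map_smul]
    module
  · have h1 := hα.exp.smul ((hasDerivAt_frame_symm B (τ t)).scomp t hτ)
    have h2 : (fun s => ((homothety (α s) * frame B (τ s)).symm : Pp n →L[ℝ] Pp n))
        = fun s => Real.exp (α s) • ((frame B (τ s)).symm : Pp n →L[ℝ] Pp n) := by
      funext s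
      refine ContinuousLinearMap.ext fun X => ?_
      change (frame B (τ s)).symm (Real.exp (α s) • X) = _
      rw [map_smul]
      rfl
    rw [h2]
    refine h1.congr_deriv (ContinuousLinearMap.ext fun X => ?_)
    change Real.exp (α t) • τ' • ((frame B (τ t)).symm (rotated B (τ t) X))
        + (Real.exp (α t) * α') • (frame B (τ t)).symm X
      = -((frame B (τ t)).symm (Real.exp (α t) • -(α' • X + τ' • rotated B (τ t) X)))
    simp only [map_smul, map_add, map_neg]
    module

namespace IsSemiAlgebraicSoliton

variable {μ : Bil q n} {c : ℝ} {D : Gg q n →L[ℝ] Gg q n} (hsol : IsSemiAlgebraicSoliton μ c D)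
include hsol

lemma exp_inK (t : ℝ) (Z : Kk q) : expEquiv (t • D) (inK Z) = inK Z := by
  have h0 : ContinuousLinearMap.inl ℝ (Kk q) (Pp n) ∘L (0 : Kk q →L[ℝ] Kk q)
      = D ∘L ContinuousLinearMap.inl ℝ (Kk q) (Pp n) := by
    refine ContinuousLinearMap.ext fun W => ?_
    rw [ContinuousLinearMap.comp_apply, ContinuousLinearMap.comp_apply, zero_apply, map_zero]
    exact (hsol.vanish W).symm
  have h1 := comp_exp_smul_eq _ _ _ h0 t
  rw [smul_zero, NormedSpace.exp_zero] at h1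
  exact congr($h1 Z).symm

lemma apply_snd (X : Gg q n) : (D X).2 = pBlock D X.2 := by
  conv_lhs => rw [← inK_add_inP X, map_add, hsol.vanish, zero_add]
  rfl

lemma exp_snd (t : ℝ) (X : Gg q n) : (expEquiv (t • D) X).2 = expGL (t • pBlock D) X.2 :=
  congr($(comp_exp_smul_eq (ContinuousLinearMap.snd ℝ (Kk q) (Pp n)) D (pBlock D)
    (ContinuousLinearMap.ext hsol.apply_snd) t) X)

variable (h : IsHomogeneous μ)
include h

/-- This is the `𝔭`-component of the derivation identity at `(Z, X)`, where `DZ = 0`. -/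
lemma isoRep_pBlock (Z : Kk q) (X : Pp n) :
    isoRep μ Z (pBlock D X) = pBlock D (isoRep μ Z X) := by
  have h1 := congr(($(hsol.derivation (inK Z) (inP X))).2)
  rw [hsol.vanish, map_zero, zero_apply, zero_add, h.bracket_inK_inP, hsol.apply_snd,
    ← inK_add_inP (D (inP X)), map_add, h.bracket_inK_inK, h.bracket_inK_inP, hsol.apply_snd,
    Prod.snd_add] at h1
  exact (h1.trans (zero_add _)).symm

/-- The isotropy operators are skew, so their commutant is closed under transposition. This is what
allows the factor `e^{tA}`. -/
lemma isoRep_adjoint_pBlock (Z : Kk q) (X : Pp n) :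
    isoRep μ Z (ContinuousLinearMap.adjoint (pBlock D) X)
      = ContinuousLinearMap.adjoint (pBlock D) (isoRep μ Z X) := by
  refine ext_inner_right ℝ fun Y => ?_
  rw [h.inner_isoRep, ContinuousLinearMap.adjoint_inner_left,
    ContinuousLinearMap.adjoint_inner_left, h.inner_isoRep, hsol.isoRep_pBlock h]

omit hsol h in
lemma _root_.BracketFlow.isoRep_expGL {B : Pp n →L[ℝ] Pp n} {Z : Kk q}
    (hB : ∀ X, isoRep μ Z (B X) = B (isoRep μ Z X)) (t : ℝ) (X : Pp n) :
    isoRep μ Z (expGL (t • B) X) = expGL (t • B) (isoRep μ Z X) :=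
  congr($(comp_exp_smul_eq (isoRep μ Z).toContinuousLinearMap B B
    (ContinuousLinearMap.ext hB) t) X)

lemma isoRep_exp_skewPart (t : ℝ) (Z : Kk q) (X : Pp n) :
    isoRep μ Z (expGL (t • skewPart (pBlock D)) X)
      = expGL (t • skewPart (pBlock D)) (isoRep μ Z X) := by
  refine isoRep_expGL (fun Y => ?_) t X
  change isoRep μ Z ((1 / 2 : ℝ) • (pBlock D Y - ContinuousLinearMap.adjoint (pBlock D) Y))
    = (1 / 2 : ℝ) • (pBlock D _ - ContinuousLinearMap.adjoint (pBlock D) _)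
  rw [map_smul, map_sub, hsol.isoRep_pBlock h, hsol.isoRep_adjoint_pBlock h]

lemma isoRep_exp_neg (t : ℝ) (Z : Kk q) (X : Pp n) :
    isoRep μ Z (expGL (-(t • pBlock D)) X) = expGL (-(t • pBlock D)) (isoRep μ Z X) := by
  rw [← show (-t) • pBlock D = -(t • pBlock D) from neg_smul t (pBlock D)]
  exact isoRep_expGL (hsol.isoRep_pBlock h Z) (-t) X

lemma isHomogeneous_act_exp_neg (t : ℝ) :
    IsHomogeneous (act (idBlock (expGL (-(t • pBlock D)))) μ) :=
  h.act_idBlock (hsol.isoRep_exp_neg h t)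

lemma isHomogeneous_solitonCurve (t : ℝ) : IsHomogeneous (solitonCurve D μ t) :=
  h.act_idBlock fun Z X => by
    change isoRep μ Z (expGL (t • skewPart (pBlock D)) (expGL (-(t • pBlock D)) X)) = _
    rw [hsol.isoRep_exp_skewPart h, hsol.isoRep_exp_neg h]
    rfl

-- Inserting the automorphism `e^{tD}` costs nothing and turns the block-diagonal change of bracket
-- into a unipotent one.
omit h in
lemma act_exp_neg_eq (t : ℝ) :
    act (idBlock (expGL (-(t • pBlock D)))) μ
      = act (idBlock (expGL (-(t • pBlock D))) * expEquiv (t • D)) μ := by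
  rw [act_mul, hsol.derivation.act_exp]

omit h in
lemma exp_neg_mul_snd (t : ℝ) (X : Gg q n) :
    ((idBlock (expGL (-(t • pBlock D))) * expEquiv (t • D) : Gg q n ≃L[ℝ] Gg q n) X).2 = X.2 := by
  change expGL (-(t • pBlock D)) (expEquiv (t • D) X).2 = X.2
  rw [hsol.exp_snd]
  exact congr($(exp_neg_mul_exp (t • pBlock D)) X.2)

omit h in
lemma exp_neg_mul_inK (t : ℝ) (Z : Kk q) :
    (idBlock (expGL (-(t • pBlock D))) * expEquiv (t • D) : Gg q n ≃L[ℝ] Gg q n) (inK Z)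
      = inK Z := by
  change idBlock _ (expEquiv (t • D) (inK Z)) = _
  rw [hsol.exp_inK, idBlock_inK]

/-- Only the reductive complement changes, by `act_exp_neg_eq`. The new complement is invariant
under the isotropy because the block-diagonal description is already known to be homogeneous. -/
lemma ricForm_act_exp_neg (t : ℝ) (X Y : Pp n) :
    ricForm (act (idBlock (expGL (-(t • pBlock D)))) μ) X Y = ricForm μ X Y := by
  have hkp := (hsol.isHomogeneous_act_exp_neg h t).kp
  rw [hsol.act_exp_neg_eq] at hkp ⊢
  exact h.ricForm_unipotent (hsol.exp_neg_mul_inK t) (hsol.exp_neg_mul_snd t) hkp X Y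

/-- The homogeneous spaces along the curve are isometric to the initial one. -/
lemma isometric_solitonCurve (t : ℝ) : Isometric μ (solitonCurve D μ t) := by
  obtain ⟨S, -⟩ := h.closed
  have h1 : solitonCurve D μ t = act (idBlock (expGL (t • skewPart (pBlock D)))
      * (idBlock (expGL (-(t • pBlock D))) * expEquiv (t • D))) μ := by
    rw [solitonCurve_eq, frame, idBlock_mul, act_mul, act_mul, hsol.act_exp_neg_eq]
  rw [h1]
  refine isometric_act S (fun Z => ?_) fun X => ?_
  · change idBlock _ ((idBlock (expGL (-(t • pBlock D))) * expEquiv (t • D) :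
      Gg q n ≃L[ℝ] Gg q n) (inK Z)) = _
    rw [hsol.exp_neg_mul_inK, idBlock_inK]
  · change ‖expGL (t • skewPart (pBlock D)) _‖ = _
    rw [@norm_eq_sqrt_real_inner _ _ _, inner_exp_skewPart, ← @norm_eq_sqrt_real_inner _ _ _]
    exact congr_arg _ (hsol.exp_neg_mul_snd t X)

/-- The factor `e^{-tB}` does not affect the Ricci form, so only the conformal map `e^{-x} e^{tA}`
acts: it conjugates `cI + S` by `e^{tA}` and rescales by `e^{2x}`. -/
lemma Ric_homothety_frame (x t : ℝ) :
    Ric (act (idBlock (homothety x * frame (pBlock D) t)) μ)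
      = Real.exp (2 * x) • (c • ContinuousLinearMap.id ℝ (Pp n) + rotated (pBlock D) t) := by
  set O := expGL (t • skewPart (pBlock D)) with hO
  have hg : ∀ X Y, ⟪(homothety x * O : Pp n ≃L[ℝ] Pp n) X, (homothety x * O : Pp n ≃L[ℝ] Pp n) Y⟫_ℝ
      = Real.exp (-(2 * x)) * ⟪X, Y⟫_ℝ := fun X Y => by
    change ⟪Real.exp (-x) • O X, Real.exp (-x) • O Y⟫_ℝ = _
    rw [real_inner_smul_left, real_inner_smul_right, hO, inner_exp_skewPart, ← mul_assoc,
      ← Real.exp_add]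
    ring_nf
  have hν : act (idBlock (homothety x * frame (pBlock D) t)) μ
      = act (idBlock (homothety x * O)) (act (idBlock (expGL (-(t • pBlock D)))) μ) := by
    rw [← act_mul]
    rfl
  refine ContinuousLinearMap.ext fun Y => ext_inner_left ℝ fun X => ?_
  obtain ⟨X, rfl⟩ := (homothety x * O : Pp n ≃L[ℝ] Pp n).surjective X
  obtain ⟨Y, rfl⟩ := (homothety x * O : Pp n ≃L[ℝ] Pp n).surjective Y
  rw [inner_Ric, hν, ricForm_act_idBlock (Real.exp_pos _).ne' hg, hsol.ricForm_act_exp_neg h,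
    ← inner_Ric, hsol.ric]
  have h1 : (Real.exp (2 * x) • (c • ContinuousLinearMap.id ℝ (Pp n) + rotated (pBlock D) t))
      ((homothety x * O : Pp n ≃L[ℝ] Pp n) Y) = Real.exp (2 * x) • (homothety x * O : Pp n ≃L[ℝ] Pp n)
        ((c • ContinuousLinearMap.id ℝ (Pp n) + symPart (pBlock D)) Y) := by
    change Real.exp (2 * x) • (c • (Real.exp (-x) • O Y) + O (symPart (pBlock D) (O.symm
      (Real.exp (-x) • O Y)))) = Real.exp (2 * x) • Real.exp (-x) • O (c • Y + symPart (pBlock D) Y)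
    simp only [map_smul, map_add, O.symm_apply_apply]
    module
  rw [h1, real_inner_smul_right, hg, ← mul_assoc, ← Real.exp_add, add_neg_cancel, Real.exp_zero,
    one_mul]
  rfl

/-- The rescaled and reparametrized curve is a normalized bracket flow. -/
lemma hasDerivAt_homothety_frame {α τ : ℝ → ℝ} {r t : ℝ}
    (hα : HasDerivAt α (r + c * Real.exp (2 * α t)) t)
    (hτ : HasDerivAt τ (Real.exp (2 * α t)) t) :
    HasDerivAt (fun s => act (idBlock (homothety (α s) * frame (pBlock D) (τ s))) μ)
      (-piRep (zeroBlock (Ric (act (idBlock (homothety (α t) * frame (pBlock D) (τ t))) μ)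
          + r • ContinuousLinearMap.id ℝ (Pp n)))
        (act (idBlock (homothety (α t) * frame (pBlock D) (τ t))) μ)) t := by
  have h0 := BracketFlow.hasDerivAt_homothety_frame (B := pBlock D) hα hτ μ
  have h1 : -((r + c * Real.exp (2 * α t)) • ContinuousLinearMap.id ℝ (Pp n)
        + Real.exp (2 * α t) • rotated (pBlock D) (τ t))
      = -(Ric (act (idBlock (homothety (α t) * frame (pBlock D) (τ t))) μ)
        + r • ContinuousLinearMap.id ℝ (Pp n)) := by
    rw [hsol.Ric_homothety_frame h]
    refine ContinuousLinearMap.ext fun X => ?_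
    change -((r + c * Real.exp (2 * α t)) • X + Real.exp (2 * α t) • rotated (pBlock D) (τ t) X)
      = -(Real.exp (2 * α t) • (c • X + rotated (pBlock D) (τ t) X) + r • X)
    module
  rw [h1, piRep_zeroBlock_neg] at h0
  exact h0

end IsSemiAlgebraicSoliton

/-! ### Ordinary differential equations -/

section ODE

open Filter Topology

lemma hasDerivAt_integral_of_continuous {f : ℝ → ℝ} (hf : Continuous f) (a t : ℝ) :
    HasDerivAt (fun s => ∫ x in a..s, f x) (f t) t :=
  intervalIntegral.integral_hasDerivAt_right (hf.intervalIntegrable _ _)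
    hf.aestronglyMeasurable.stronglyMeasurableAtFilter hf.continuousAt

/-- Local solvability of `α' = r + c e^{2α}`, `τ' = e^{2α}`. -/
lemma exists_local_rescaling {J : Set ℝ} (hJ : IsOpen J) {r : ℝ → ℝ} (hr : ContinuousOn r J) {t₀ : ℝ}
    (ht₀ : t₀ ∈ J) (c : ℝ) :
    ∃ α τ : ℝ → ℝ, α t₀ = 0 ∧ τ t₀ = t₀ ∧ ∀ᶠ t in 𝓝 t₀,
      HasDerivAt α (r t + c * Real.exp (2 * α t)) t ∧ HasDerivAt τ (Real.exp (2 * α t)) t := by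
  obtain ⟨ε, hε, hball⟩ := Metric.isOpen_iff.1 hJ t₀ ht₀
  have hle : t₀ - ε / 2 ≤ t₀ + ε / 2 := by linarith
  have hsub : Set.Icc (t₀ - ε / 2) (t₀ + ε / 2) ⊆ J := fun x hx => hball <| by
    rw [Metric.mem_ball, Real.dist_eq, abs_lt]
    constructor <;> linarith [hx.1, hx.2]
  -- `r` is continuous only on `J`; a global continuous function that equals `r` near `t₀` makes the
  -- integrals below well behaved everywhere.
  set ρ : ℝ → ℝ := Set.IccExtend hle ((Set.Icc (t₀ - ε / 2) (t₀ + ε / 2)).domRestrict r)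
  have hρ : Continuous ρ :=
    (continuousOn_iff_continuous_domRestrict.1 (hr.mono hsub)).Icc_extend'
  have hρr : ∀ᶠ t in 𝓝 t₀, ρ t = r t := by
    filter_upwards [Icc_mem_nhds (a := t₀ - ε / 2) (b := t₀ + ε / 2) (x := t₀) (by linarith)
      (by linarith)] with t ht
    exact Set.IccExtend_of_mem _ _ ht
  set R : ℝ → ℝ := fun t => ∫ x in t₀..t, ρ x
  have hR : ∀ t, HasDerivAt R (ρ t) t := hasDerivAt_integral_of_continuous hρ t₀
  have hRc : Continuous R := continuous_iff_continuousAt.2 fun t => (hR t).continuousAt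
  set I : ℝ → ℝ := fun t => ∫ x in t₀..t, Real.exp (2 * R x)
  have hI : ∀ t, HasDerivAt I (Real.exp (2 * R t)) t :=
    hasDerivAt_integral_of_continuous (by fun_prop) t₀
  -- The substitution `b = e^{-2α}` linearizes `α' = r + c e^{2α}` to `b' = -2(rb + c)`; this is its
  -- solution with `b(t₀) = 1`.
  set b : ℝ → ℝ := fun t => Real.exp (-(2 * R t)) * (1 - 2 * c * I t)
  have hb : ∀ t, HasDerivAt b (-2 * (ρ t * b t + c)) t := fun t => by
    have h1 := ((hR t).const_mul 2).neg.exp.mul (((hI t).const_mul (2 * c)).const_sub 1)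
    refine h1.congr_deriv ?_
    have h2 : Real.exp (-(2 * R t)) * Real.exp (2 * R t) = 1 := by
      rw [← Real.exp_add, neg_add_cancel, Real.exp_zero]
    simp only [b, Pi.neg_apply]
    linear_combination -2 * c * h2
  have hbc : Continuous b := continuous_iff_continuousAt.2 fun t => (hb t).continuousAt
  have hR0 : R t₀ = 0 := intervalIntegral.integral_same
  have hI0 : I t₀ = 0 := intervalIntegral.integral_same
  have hb0 : b t₀ = 1 := by simp [b, hR0, hI0]
  have hbpos : ∀ᶠ t in 𝓝 t₀, 1 / 2 < b t :=
    hbc.continuousAt.eventually (lt_mem_nhds (by rw [hb0]; norm_num))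
  -- `b` may vanish away from `t₀`, where `α` blows up. The truncation keeps the integrand for `τ`
  -- continuous on the whole line and changes nothing near `t₀`.
  have hmax : Continuous fun t => (max (b t) (1 / 2))⁻¹ :=
    (hbc.max continuous_const).inv₀ fun t => (lt_max_of_lt_right (by norm_num)).ne'
  refine ⟨fun t => -(1 / 2) * Real.log (b t), fun t => t₀ + ∫ x in t₀..t, (max (b x) (1 / 2))⁻¹,
    by simp [hb0], by simp, ?_⟩
  filter_upwards [hρr, hbpos] with t h1 h2
  have h3 : (0 : ℝ) < b t := by linarith
  have h4 : Real.exp (2 * (-(1 / 2) * Real.log (b t))) = (b t)⁻¹ := by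
    rw [show 2 * (-(1 / 2) * Real.log (b t)) = -Real.log (b t) by ring, Real.exp_neg,
      Real.exp_log h3]
  rw [h4]
  constructor
  · refine (((hb t).log h3.ne').const_mul (-(1 / 2))).congr_deriv ?_
    rw [← h1]
    field_simp
  · refine ((hasDerivAt_integral_of_continuous hmax t₀ t).const_add t₀).congr_deriv ?_
    rw [max_eq_left h2.le]

/-- The time dependence enters only through the scalar `r`, which is bounded near `t₀`, so `V + r W`
has a Lipschitz constant uniform in time although `r` is merely continuous. -/
lemma eventuallyEq_of_hasDerivAt {E : Type*} [NormedAddCommGroup E] [NormedSpace ℝ E]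
    {V W : E → E} (hV : ContDiff ℝ 1 V) (hW : ContDiff ℝ 1 W) {r : ℝ → ℝ} {t₀ : ℝ}
    (hr : ContinuousAt r t₀) {f g : ℝ → E} (heq : f t₀ = g t₀)
    (hf : ∀ᶠ t in 𝓝 t₀, HasDerivAt f (V (f t) + r t • W (f t)) t)
    (hg : ∀ᶠ t in 𝓝 t₀, HasDerivAt g (V (g t) + r t • W (g t)) t) : f =ᶠ[𝓝 t₀] g := by
  obtain ⟨K, s, hs, hK⟩ := hV.contDiffAt.exists_lipschitzOnWith (x := f t₀)
  obtain ⟨L, u, hu, hL⟩ := hW.contDiffAt.exists_lipschitzOnWith (x := f t₀)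
  have hbd : ∀ᶠ t in 𝓝 t₀, ‖r t‖₊ < ‖r t₀‖₊ + 1 :=
    hr.nnnorm.eventually (gt_mem_nhds (lt_add_one _))
  refine ODE_solution_unique_of_eventually (K := K + (‖r t₀‖₊ + 1) * L)
    (v := fun t x => V x + r t • W x) (s := fun _ => s ∩ u) ?_ ?_ ?_ heq
  · filter_upwards [hbd] with t ht
    have h1 : LipschitzOnWith ((‖r t₀‖₊ + 1) * L) (fun x => r t • W x) u := by
      refine LipschitzOnWith.weaken ?_ (mul_le_mul_left ht.le L)
      refine LipschitzOnWith.of_dist_le_mul fun x hx y hy => ?_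
      rw [dist_smul₀, NNReal.coe_mul, coe_nnnorm, mul_assoc]
      exact mul_le_mul_of_nonneg_left (hL.dist_le_mul x hx y hy) (norm_nonneg _)
    exact (hK.mono Set.inter_subset_left).add (h1.mono Set.inter_subset_right)
  · have := hf.self_of_nhds.continuousAt.eventually (inter_mem hs hu)
    filter_upwards [hf, this] with t h1 h2 using ⟨h1, h2⟩
  · have := hg.self_of_nhds.continuousAt.eventually (heq ▸ inter_mem hs hu)
    filter_upwards [hg, this] with t h1 h2 using ⟨h1, h2⟩

end ODE

/-! ### Smoothness of the vector field -/

section Smooth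

lemma contDiff_compL_comp {H E : Type*} [NormedAddCommGroup H] [NormedSpace ℝ H]
    [NormedAddCommGroup E] [NormedSpace ℝ E] {L A B : H → E →L[ℝ] E} {μ : H → E →L[ℝ] E →L[ℝ] E}
    (hL : ContDiff ℝ 1 L) (hA : ContDiff ℝ 1 A) (hB : ContDiff ℝ 1 B) (hμ : ContDiff ℝ 1 μ) :
    ContDiff ℝ 1
      (fun x => (ContinuousLinearMap.compL ℝ E E E (L x)).comp ((μ x).bilinearComp (A x) (B x))) :=
  ((ContinuousLinearMap.compL ℝ E E E).contDiff.comp hL).clm_comp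
    (((ContinuousLinearMap.compL ℝ E E E).flip.contDiff.comp hB).clm_comp (hμ.clm_comp hA))

lemma contDiff_piRep_zeroBlock {E : Bil q n → Pp n →L[ℝ] Pp n} (hE : ContDiff ℝ 1 E) :
    ContDiff ℝ 1 (fun μ : Bil q n => -piRep (zeroBlock (E μ)) μ) := by
  have h1 : ContDiff ℝ 1 (fun μ : Bil q n => (zeroBlock (E μ) : Gg q n →L[ℝ] Gg q n)) := by
    have h2 : ∀ B : Pp n →L[ℝ] Pp n, zeroBlock B = (ContinuousLinearMap.inr ℝ (Kk q) (Pp n) ∘L B)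
        ∘L ContinuousLinearMap.snd ℝ (Kk q) (Pp n) := fun B => ContinuousLinearMap.ext fun X => rfl
    simp only [h2]
    exact (contDiff_const.clm_comp hE).clm_comp contDiff_const
  have hid : ContDiff ℝ 1 (fun _ : Bil q n => ContinuousLinearMap.id ℝ (Gg q n)) := contDiff_const
  exact (((contDiff_compL_comp h1 hid hid contDiff_id).sub
    (contDiff_compL_comp hid h1 hid contDiff_id)).sub
    (contDiff_compL_comp hid hid h1 contDiff_id)).neg

/-- The trace as a continuous linear functional. -/
def traceCLM (q n : ℕ) : (Gg q n →L[ℝ] Gg q n) →L[ℝ] ℝ :=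
  LinearMap.toContinuousLinearMap
    { toFun := fun L => LinearMap.trace ℝ (Gg q n) L.toLinearMap
      map_add' := fun L M => by simp
      map_smul' := fun a L => by simp }

lemma contDiff_apply (X : Gg q n) : ContDiff ℝ 1 (fun μ : Bil q n => μ X) :=
  contDiff_id.clm_apply contDiff_const

lemma contDiff_killing (X Y : Gg q n) : ContDiff ℝ 1 (fun μ : Bil q n => killing μ X Y) :=
  (traceCLM q n).contDiff.comp ((contDiff_apply X).clm_comp (contDiff_apply Y))

lemma contDiff_meanVec : ContDiff ℝ 1 (fun μ : Bil q n => meanVec μ) :=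
  ContDiff.sum fun i _ =>
    ((traceCLM q n).contDiff.comp (contDiff_apply (inP (e i)))).smul contDiff_const

lemma contDiff_brP {X Y : Bil q n → Pp n} (hX : ContDiff ℝ 1 X) (hY : ContDiff ℝ 1 Y) :
    ContDiff ℝ 1 (fun μ : Bil q n => brP μ (X μ) (Y μ)) := by
  have hP : ContDiff ℝ 1 (ContinuousLinearMap.inr ℝ (Kk q) (Pp n)) :=
    ContinuousLinearMap.contDiff _
  exact ((contDiff_id.clm_apply (hP.comp hX)).clm_apply (hP.comp hY)).snd

lemma contDiff_inner_Pp {H : Type*} [NormedAddCommGroup H] [NormedSpace ℝ H] {f g : H → Pp n}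
    (hf : ContDiff ℝ 1 f) (hg : ContDiff ℝ 1 g) : ContDiff ℝ 1 (fun x => ⟪f x, g x⟫_ℝ) :=
  hf.inner ℝ hg

lemma contDiff_ricForm_aux {H : Type*} [NormedAddCommGroup H] [NormedSpace ℝ H]
    {b : Pp n → Pp n → H → Pp n} {m₁ m₂ : H → Pp n} {k : H → ℝ} (hb : ∀ U V, ContDiff ℝ 1 (b U V))
    (hm₁ : ContDiff ℝ 1 m₁) (hm₂ : ContDiff ℝ 1 m₂) (hk : ContDiff ℝ 1 k) (X Y : Pp n) :
    ContDiff ℝ 1 (fun x => -(1 / 2) * ∑ i, ⟪b X (e i) x, b Y (e i) x⟫_ℝ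
      + (1 / 4) * ∑ i, ∑ j, ⟪b (e i) (e j) x, X⟫_ℝ * ⟪b (e i) (e j) x, Y⟫_ℝ
      - (1 / 2) * k x - (1 / 2) * (⟪m₁ x, Y⟫_ℝ + ⟪X, m₂ x⟫_ℝ)) := by
  have h1 : ContDiff ℝ 1 (fun x => ∑ i, ⟪b X (e i) x, b Y (e i) x⟫_ℝ) :=
    ContDiff.sum fun i _ => contDiff_inner_Pp (hb _ _) (hb _ _)
  have h2 : ContDiff ℝ 1 (fun x => ∑ i, ∑ j, ⟪b (e i) (e j) x, X⟫_ℝ * ⟪b (e i) (e j) x, Y⟫_ℝ) :=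
    ContDiff.sum fun i _ => ContDiff.sum fun j _ =>
      (contDiff_inner_Pp (hb _ _) contDiff_const).mul (contDiff_inner_Pp (hb _ _) contDiff_const)
  have h3 := contDiff_inner_Pp hm₁ (contDiff_const (c := Y))
  have h4 := contDiff_inner_Pp (contDiff_const (c := X)) hm₂
  exact (((contDiff_const.mul h1).add (contDiff_const.mul h2)).sub
    (contDiff_const.mul hk)).sub (contDiff_const.mul (h3.add h4))

lemma contDiff_ricForm (X Y : Pp n) : ContDiff ℝ 1 (fun μ : Bil q n => ricForm μ X Y) :=
  contDiff_ricForm_aux (b := fun U V (μ : Bil q n) => brP μ U V)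
    (m₁ := fun μ => brP μ (meanVec μ) X) (m₂ := fun μ => brP μ (meanVec μ) Y)
    (fun _ _ => contDiff_brP contDiff_const contDiff_const)
    (contDiff_brP contDiff_meanVec contDiff_const) (contDiff_brP contDiff_meanVec contDiff_const)
    (contDiff_killing (inP X) (inP Y)) X Y

lemma contDiff_Ric : ContDiff ℝ 1 (fun μ : Bil q n => Ric μ) := by
  -- Expansion in fixed rank-one operators, which reduces smoothness to the scalar coefficients.
  have h1 : ∀ μ : Bil q n, Ric μ = ∑ i, ∑ j, ricForm μ (e i) (e j) •
      ((innerSL ℝ (e j)).smulRight (e i) : Pp n →L[ℝ] Pp n) := fun μ => by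
    refine ContinuousLinearMap.ext fun Y => ext_inner_left ℝ fun X => ?_
    rw [inner_Ric]
    conv_lhs => rw [← ricBil_apply, ← sum_inner_smul_e X, ← sum_inner_smul_e Y]
    simp only [map_sum, map_smul, LinearMap.sum_apply, LinearMap.smul_apply, inner_sum, sum_apply,
      smul_apply, ContinuousLinearMap.smulRight_apply, innerSL_apply_apply, real_inner_smul_right,
      ricBil_apply, smul_eq_mul, Finset.mul_sum]
    rw [Finset.sum_comm]
    refine Finset.sum_congr rfl fun i _ => Finset.sum_congr rfl fun j _ => ?_
    rw [real_inner_comm X]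
    ring
  simp only [h1]
  exact ContDiff.sum fun i _ => ContDiff.sum fun j _ =>
    (contDiff_ricForm (e i) (e j)).smul contDiff_const

end Smooth

lemma piRep_zeroBlock_add_smul (E : Pp n →L[ℝ] Pp n) (r : ℝ) (μ : Bil q n) :
    -piRep (zeroBlock (E + r • ContinuousLinearMap.id ℝ (Pp n))) μ
      = -piRep (zeroBlock E) μ + r • -piRep (zeroBlock (ContinuousLinearMap.id ℝ (Pp n))) μ := by
  have h : ∀ X : Gg q n, zeroBlock (E + r • ContinuousLinearMap.id ℝ (Pp n)) X
      = zeroBlock E X + r • zeroBlock (ContinuousLinearMap.id ℝ (Pp n)) X := fun X => by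
    change ((0, E X.2 + r • X.2) : Gg q n) = (0, E X.2) + r • (0, X.2)
    simp
  refine bil_ext fun X Y => ?_
  simp only [neg_apply, add_apply, smul_apply, piRep_apply, h, map_add, map_smul]
  module

/-- Two normalized bracket flows with the same normalization that meet agree locally. -/
lemma bracketFlow_eventuallyEq {r : ℝ → ℝ} {t₀ : ℝ} (hr : ContinuousAt r t₀)
    {μ ν : ℝ → Bil q n} (heq : μ t₀ = ν t₀)
    (hμ : ∀ᶠ t in nhds t₀, HasDerivAt μ
      (-piRep (zeroBlock (Ric (μ t) + r t • ContinuousLinearMap.id ℝ (Pp n))) (μ t)) t)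
    (hν : ∀ᶠ t in nhds t₀, HasDerivAt ν
      (-piRep (zeroBlock (Ric (ν t) + r t • ContinuousLinearMap.id ℝ (Pp n))) (ν t)) t) :
    μ =ᶠ[nhds t₀] ν := by
  simp only [piRep_zeroBlock_add_smul] at hμ hν
  exact eventuallyEq_of_hasDerivAt (contDiff_piRep_zeroBlock contDiff_Ric)
    (contDiff_piRep_zeroBlock contDiff_const) hr heq hμ hν

/-! ### Flow and uniqueness -/

/-- Two differentiable curves that agree near every point where they meet are equal. -/
lemma eq_of_eventuallyEq_of_eq {E : Type*} [NormedAddCommGroup E] [NormedSpace ℝ E] {f g : ℝ → E}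
    {J : Set ℝ} (hJ : IsOpen J) (hJc : J.OrdConnected) {t₀ : ℝ} (ht₀ : t₀ ∈ J)
    (hf : ∀ t ∈ J, ∃ f', HasDerivAt f f' t) (hg : ∀ t ∈ J, ∃ g', HasDerivAt g g' t)
    (heq : f t₀ = g t₀) (hloc : ∀ t ∈ J, f t = g t → f =ᶠ[nhds t] g) {t : ℝ} (ht : t ∈ J) :
    f t = g t := by
  let U : Set ℝ := {s | s ∈ J ∧ f s = g s}
  -- The coincidence set is open by local agreement and relatively closed in `J` by continuity.
  have hU : IsOpen U := isOpen_iff_mem_nhds.2 fun s hs =>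
    Filter.inter_mem (hJ.mem_nhds hs.1) (hloc s hs.1 hs.2)
  have hsub : J ⊆ U := by
    refine hJc.isPreconnected.subset_of_closure_inter_subset hU ⟨t₀, ht₀, ht₀, heq⟩
      fun s hs => ⟨hs.2, ?_⟩
    obtain ⟨f', hf'⟩ := hf s hs.2
    obtain ⟨g', hg'⟩ := hg s hs.2
    exact tendsto_nhds_unique_of_frequently_eq hf'.continuousAt hg'.continuousAt
      ((mem_closure_iff_frequently.1 hs.1).mono fun x hx => hx.2)
  exact (hsub ht).2

lemma frame_zero (B : Pp n →L[ℝ] Pp n) : frame B 0 = 1 := by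
  refine ContinuousLinearEquiv.ext (funext fun X => ?_)
  have h1 : (0 : ℝ) • skewPart B = 0 := zero_smul ℝ (skewPart B)
  have h2 : -((0 : ℝ) • B) = 0 := by
    rw [show (0 : ℝ) • B = 0 from zero_smul ℝ B, neg_zero]
  change NormedSpace.exp ((0 : ℝ) • skewPart B) (NormedSpace.exp (-((0 : ℝ) • B)) X) = X
  rw [h1, h2, NormedSpace.exp_zero]
  rfl

lemma solitonCurve_zero (D : Gg q n →L[ℝ] Gg q n) (μ : Bil q n) : solitonCurve D μ 0 = μ := by
  rw [solitonCurve_eq, frame_zero]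
  exact act_one μ

namespace IsSemiAlgebraicSoliton

variable {μ : Bil q n} {c : ℝ} {D : Gg q n →L[ℝ] Gg q n} (hsol : IsSemiAlgebraicSoliton μ c D)
  (h : IsHomogeneous μ)
include hsol h

/-- The case `α = 0`, `τ = t` of the rescaled family; `r = -c` is exactly what makes `α = 0`
stationary for `α' = r + c e^{2α}`. -/
lemma isBracketFlow_solitonCurve :
    IsBracketFlow Set.univ (fun _ => -c) μ (solitonCurve D μ) := by
  refine ⟨solitonCurve_zero D μ, fun t _ => ?_⟩
  have h0 := hsol.hasDerivAt_homothety_frame h (α := fun _ => 0) (τ := fun s => s) (r := -c) (t := t)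
    (by simpa using hasDerivAt_const t (0 : ℝ)) (by simpa using hasDerivAt_id' t)
  simp only [homothety_zero, one_mul] at h0
  exact h0

lemma act_homothety_frame (x t : ℝ) :
    act (idBlock (homothety x * frame (pBlock D) t)) μ
      = scale (Real.exp x) (solitonCurve D μ t) := by
  rw [(hsol.isHomogeneous_solitonCurve h t).scale_exp, solitonCurve_eq, ← act_mul, ← idBlock_mul]

/-- A normalized bracket flow that keeps a scaling function constant agrees with the soliton curve
near every point where they meet. -/
lemma eventuallyEq_solitonCurve {F : Bil q n → ℝ} {d : ℝ} (hd : d ≠ 0)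
    (hscale : ∀ x t, F (scale (Real.exp x) (solitonCurve D μ t)) = Real.exp x ^ d * F μ)
    (hF : F μ ≠ 0) {J : Set ℝ} (hJ : IsOpen J) {r : ℝ → ℝ} (hr : ContinuousOn r J)
    {ν : ℝ → Bil q n} (hν : IsBracketFlow J r μ ν) (hconst : ∀ t ∈ J, F (ν t) = F μ) {t₀ : ℝ}
    (ht₀ : t₀ ∈ J) (heq : ν t₀ = solitonCurve D μ t₀) : ν =ᶠ[nhds t₀] solitonCurve D μ := by
  obtain ⟨α, τ, hα0, hτ0, hατ⟩ := exists_local_rescaling hJ hr ht₀ c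
  have hJ' : ∀ᶠ t in nhds t₀, t ∈ J := hJ.mem_nhds ht₀
  have h1 : ν =ᶠ[nhds t₀] fun t => act (idBlock (homothety (α t) * frame (pBlock D) (τ t))) μ := by
    refine bracketFlow_eventuallyEq (hr.continuousAt (hJ.mem_nhds ht₀)) ?_
      (hJ'.mono fun t ht => hν.2 t ht)
      (hατ.mono fun t ht => hsol.hasDerivAt_homothety_frame h ht.1 ht.2)
    rw [heq, hα0, hτ0, homothety_zero, one_mul, solitonCurve_eq]
  have h2 : ∀ᶠ t in nhds t₀, α t = 0 := by
    filter_upwards [h1, hJ'] with t e1 e2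
    have e3 := hconst t e2
    rw [e1, hsol.act_homothety_frame h, hscale] at e3
    have e4 : Real.exp (α t) ^ d = 1 := mul_right_cancel₀ hF (e3.trans (one_mul _).symm)
    rw [← Real.exp_mul, Real.exp_eq_one_iff] at e4
    exact (mul_eq_zero.1 e4).resolve_right hd
  -- With `α = 0` near `t₀`, the equation for `τ` becomes `τ' = 1` with `τ(t₀) = t₀`.
  have h3 : τ =ᶠ[nhds t₀] fun t => t := by
    refine ODE_solution_unique_of_eventually (v := fun _ _ => (1 : ℝ)) (K := 0)
      (s := fun _ => Set.univ) ?_ ?_ ?_ hτ0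
    · exact Filter.Eventually.of_forall fun t => LipschitzWith.const 1 |>.lipschitzOnWith
    · filter_upwards [hατ, h2] with t e1 e2
      refine ⟨?_, trivial⟩
      simpa [e2] using e1.2
    · exact Filter.Eventually.of_forall fun t => ⟨hasDerivAt_id' t, trivial⟩
  filter_upwards [h1, h2, h3] with t e1 e2 e3
  rw [e1, e2, e3, homothety_zero, one_mul, solitonCurve_eq]

set_option maxHeartbeats 1000000 in
/-- The soliton curve is the only normalized bracket flow that keeps a scaling function constant. -/
lemma eq_solitonCurve {F : Bil q n → ℝ} {d : ℝ} (hd : d ≠ 0)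
    (hscale : ∀ x t, F (scale (Real.exp x) (solitonCurve D μ t)) = Real.exp x ^ d * F μ)
    (hF : F μ ≠ 0) {J : Set ℝ} (hJ : IsOpen J) (hJc : J.OrdConnected) (h0 : (0 : ℝ) ∈ J)
    {r : ℝ → ℝ} (hr : ContinuousOn r J) {ν : ℝ → Bil q n} (hν : IsBracketFlow J r μ ν)
    (hconst : ∀ t ∈ J, F (ν t) = F μ) {t : ℝ} (ht : t ∈ J) : ν t = solitonCurve D μ t := by
  have hloc : ∀ s ∈ J, ν s = solitonCurve D μ s → ν =ᶠ[nhds s] solitonCurve D μ := fun s hs e =>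
    hsol.eventuallyEq_solitonCurve h hd hscale hF hJ hr hν hconst hs e
  exact eq_of_eventuallyEq_of_eq hJ hJc h0 (fun s hs => ⟨_, hν.2 s hs⟩)
    (fun s _ => ⟨_, (hsol.isBracketFlow_solitonCurve h).2 s (Set.mem_univ s)⟩)
    (by rw [hν.1, solitonCurve_zero]) hloc ht

end IsSemiAlgebraicSoliton

end BracketFlow

end

/-! ### Conclusion: homogeneity, flow equation, invariance of `F` and uniqueness -/

theorem mainTheorem5 (q n : ℕ) (μ₀ : BracketFlow.Bil q n) (hμ₀ : μ₀ ∈ BracketFlow.Hqn q n)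
    (c : ℝ) (D : BracketFlow.Gg q n →L[ℝ] BracketFlow.Gg q n)
    (hsol : BracketFlow.IsSemiAlgebraicSoliton μ₀ c D)
    (F : BracketFlow.Bil q n → ℝ)
    (hdiff : DifferentiableOn ℝ F (BracketFlow.Hqn q n))
    (hiso : ∀ μ ∈ BracketFlow.Hqn q n, ∀ ν ∈ BracketFlow.Hqn q n,
      BracketFlow.Isometric μ ν → F μ = F ν)
    (d : ℝ) (hd : d ≠ 0)
    (hscale : ∀ μ ∈ BracketFlow.Hqn q n, ∀ a : ℝ, 0 < a →
      F (BracketFlow.scale a μ) = a ^ d * F μ)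
    (hF : F μ₀ ≠ 0) :
    -- the curve stays in the space of homogeneous spaces, is a normalized bracket flow, keeps `F`
    (∀ t, BracketFlow.solitonCurve D μ₀ t ∈ BracketFlow.Hqn q n) ∧
    (∃ r : ℝ → ℝ, Continuous r ∧
      BracketFlow.IsBracketFlow Set.univ r μ₀ (BracketFlow.solitonCurve D μ₀)) ∧
    (∀ t, F (BracketFlow.solitonCurve D μ₀ t) = F μ₀) ∧
    -- and it is the only normalized bracket flow from `μ₀` that keeps `F`
    (∀ (J : Set ℝ) (r : ℝ → ℝ) (μ : ℝ → BracketFlow.Bil q n),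
      IsOpen J → J.OrdConnected → (0 : ℝ) ∈ J → ContinuousOn r J →
      BracketFlow.IsBracketFlow J r μ₀ μ → (∀ t ∈ J, F (μ t) = F μ₀) →
      ∀ t ∈ J, μ t = BracketFlow.solitonCurve D μ₀ t) := by
  have h : BracketFlow.IsHomogeneous μ₀ := hμ₀
  have hcurve := hsol.isHomogeneous_solitonCurve h
  have hFc : ∀ t, F (BracketFlow.solitonCurve D μ₀ t) = F μ₀ := fun t =>
    (hiso μ₀ hμ₀ _ (hcurve t) (hsol.isometric_solitonCurve h t)).symm
  have hsc : ∀ x t, F (BracketFlow.scale (Real.exp x) (BracketFlow.solitonCurve D μ₀ t))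
      = Real.exp x ^ d * F μ₀ := fun x t => by
    rw [hscale _ (hcurve t) _ (Real.exp_pos x), hFc]
  exact ⟨hcurve, ⟨fun _ => -c, continuous_const, hsol.isBracketFlow_solitonCurve h⟩, hFc,
    fun J r μ hJ hJc h0 hr hμ hconst t ht =>
      hsol.eq_solitonCurve h hd hsc hF hJ hJc h0 hr hμ hconst ht⟩
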